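/- Let $(X,d)$ be a nonempty complete metric space such that: (a) $X$ is doubling: there is a constant $C_{db}\ge 1$ such that every bounded set $A\subset X$ can be covered by $C_{db}$ or fewer sets, each of diameter at most $\tfrac12\operatorname{diam}A$; (b) $X$ is locally quasiconvex: for every compact set $E\subset X$ there is a constant $C_{qc,E}\ge 1$ such that for all $x,y\in E$ with $x\ne y$ there is a continuous map $\gamma:[0,1]\to X$ with $\gamma(0)=x$, $\gamma(1)=y$ and $\operatorname{var}(\gamma)\le C_{qc,E}\,d(x,y)$, where $\operatorname{var}(\gamma)=\sup_{0\le t_0<t_1<\cdots<t_n\le 1}\sum_{i=1}^n d(\gamma(t_{i-1}),\gamma(t_i))$. Then there exists a Borel measure $\nu$ on $X$ such that: (i) $\nu$ is doubling: there is a constant $C<\infty$ such that $0<\nu(B(x,2r))\le C\,\nu(B(x,r))<\infty$ for all $x\in X$ and all $r>0$, where $B(x,r)$ denotes the closed ball with center $x$ and radius $r$; (ii) $\operatorname{spt}\nu=X$; (iii) $\nu$ is 1-rectifiable: there is a sequence $\Gamma_1,\Gamma_2,\dots$ of rectifiable curves in $X$ such that $\nu\big(X\setminus\bigcup_{i=1}^\infty\Gamma_i\big)=0$,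 where a rectifiable curve is a set of the form $f([0,1])$ for a continuous map $f:[0,1]\to X$ with $\operatorname{var}(f)<\infty$. -/

import Mathlib

open Set MeasureTheory
open scoped ENNReal NNReal

/-- A metric space is doubling if there is a constant `C` such that every bounded set `A` can be
covered by `C` or fewer sets, each of at most half the diameter of `A`. Repeated and empty members
of the family `U` are allowed, which accounts for "or fewer". -/
def IsDoublingSpace (X : Type*) [MetricSpace X] : Prop :=
  ∃ C : ℕ, ∀ A : Set X, Bornology.IsBounded A →
    ∃ U : Fin C → Set X, A ⊆ ⋃ i, U i ∧ ∀ i, Metric.ediam (U i) ≤ Metric.ediam A / 2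

/-- A metric space is locally quasiconvex if for every compact set `E` there is a constant `C ≥ 1`
such that any two distinct points `x, y ∈ E` are joined by a parameterized curve in the whole space
of variation at most `C * d(x, y)`. -/
def IsLocallyQuasiconvex (X : Type*) [MetricSpace X] : Prop :=
  ∀ E : Set X, IsCompact E → ∃ C : ℝ≥0, 1 ≤ C ∧ ∀ x ∈ E, ∀ y ∈ E, x ≠ y →
    ∃ γ : ℝ → X, ContinuousOn γ (Icc 0 1) ∧ γ 0 = x ∧ γ 1 = y ∧
      eVariationOn γ (Icc 0 1) ≤ C * edist x y

/-- A set `Γ` is a rectifiable curve if it is the image of `[0,1]` under a continuous map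
of finite variation. -/
def IsRectifiableCurve {X : Type*} [MetricSpace X] (Γ : Set X) : Prop :=
  ∃ f : ℝ → X, ContinuousOn f (Icc 0 1) ∧ eVariationOn f (Icc 0 1) < ∞ ∧ Γ = f '' Icc 0 1

/-- A measure is 1-rectifiable if some sequence of rectifiable curves covers almost all points. -/
def IsOneRectifiable {X : Type*} [MetricSpace X] [MeasurableSpace X] (μ : Measure X) : Prop :=
  ∃ Γ : ℕ → Set X, (∀ i, IsRectifiableCurve (Γ i)) ∧ μ (univ \ ⋃ i, Γ i) = 0

/-- A measure is doubling if `0 < μ (B(x, 2r)) ≤ C μ (B(x, r)) < ∞` for all closed balls,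
with one finite constant `C`. -/
def IsDoublingMeasure {X : Type*} [MetricSpace X] [MeasurableSpace X] (μ : Measure X) : Prop :=
  ∃ C : ℝ≥0, ∀ x : X, ∀ r : ℝ, 0 < r →
    0 < μ (Metric.closedBall x (2 * r)) ∧
    μ (Metric.closedBall x (2 * r)) ≤ C * μ (Metric.closedBall x r) ∧
    C * μ (Metric.closedBall x r) < ∞

/-!
The measure `ν` is built from a tree of nets. For every `k : ℤ` choose a maximal
`100 ^ (-k)`-separated set, all of them containing a common base point, and give each point of
generation `k` a parent nearby in generation `k - 1`, so that all points deep inside the region of a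
net point have it as parent. In particular each net point has a *central* child close to it. Mass is
passed down the tree very unevenly: every noncentral child gets the same small fraction `eta ^ 2` of
the mass of its parent, and the central child gets the rest. The masses of the points of generation
`n` form a discrete measure, and `ν` is a vague limit point of these measures
(`exists_vague_limit`), which exists as the space is proper and mass is conserved.

*Doubling.* If two nearby points of the same generation have different parents, then both lie near
the boundary of the regions of their parents, so both are noncentral. Going up the tree, the masses
of two nearby points change by the same factor until their parents coincide; hence they are
comparable (`NetTree.eta_sq_mul_mass_le_mass`), uniformly in the generation. Since all nets contain
the base point, any two points do have a common ancestor, also in an unbounded space.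

*Rectifiability.* Let the *size* of a point be the product of one factor `eta` for each noncentral
point among it and its ancestors after generation `0`. The square of the size bounds the mass,
relative to that of the ancestor in generation `0`, and the sum of the sizes of
all points of generation `n` under a given point of generation `0` is at most `(3 / 2) ^ n`. So the
points of size at least `c / 2 ^ n` number at most `3 ^ n / c`, while those of smaller size carry
only the proportion `c * (3 / 4) ^ n` of the mass. As `c` tends to `0`, it follows that `ν`-almost
every point is the limit of a branch of the tree with sizes at least `c / 2 ^ n` for some `c > 0`
(`NetTree.limitMeasure_ball_diff_branchSet_le`). For fixed `c` and fixed start, the set of these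
limits sits in a tree with at most `3 ^ n / c` points at scale `100 ^ (-n)`. Since
`∑ 3 ^ n * 100 ^ (-n)` converges, listing the branches in lexicographic order gives an expanding
map of this set to a bounded subset of the line (`exists_expanding`). Its inverse is Lipschitz,
and extends over the gaps of its domain by quasiconvexity
(`IsLocallyQuasiconvex.exists_isRectifiableCurve_superset`), so that the set lies on a rectifiable
curve.
-/

/-! ### Covering numbers of doubling spaces -/

section Doubling

variable {X : Type*} [MetricSpace X]

theorem IsDoublingSpace.exists_finset_cover (h : IsDoublingSpace X) :
    ∃ C : ℕ, ∀ (n : ℕ) (A : Set X), Bornology.IsBounded A →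
      ∃ 𝒰 : Finset (Set X), 𝒰.card ≤ C ^ n ∧ A ⊆ ⋃ U ∈ 𝒰, U ∧
        ∀ U ∈ 𝒰, Metric.ediam U ≤ Metric.ediam A / 2 ^ n := by
  classical
  obtain ⟨C, hC⟩ := h
  refine ⟨C, fun n => ?_⟩
  induction n with
  | zero => exact fun A _ => ⟨{A}, by simp⟩
  | succ n ih =>
    intro A hA
    obtain ⟨𝒰, hcard, hcov, hdiam⟩ := ih A hA
    have key : ∀ U ∈ 𝒰, ∃ 𝒱 : Finset (Set X), 𝒱.card ≤ C ∧ U ⊆ ⋃ V ∈ 𝒱, V ∧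
        ∀ V ∈ 𝒱, Metric.ediam V ≤ Metric.ediam U / 2 := by
      intro U hU
      have hb : Bornology.IsBounded U := by
        rw [Metric.isBounded_iff_ediam_ne_top]
        refine ne_top_of_le_ne_top ?_ (hdiam U hU)
        exact ENNReal.div_ne_top (Metric.isBounded_iff_ediam_ne_top.1 hA) (by simp)
      obtain ⟨V, hV, hVd⟩ := hC U hb
      refine ⟨Finset.univ.image V, ?_, ?_, ?_⟩
      · exact Finset.card_image_le.trans (by simp)
      · simpa using hV
      · simpa using hVd
    choose! 𝒱 h1 h2 h3 using key
    refine ⟨𝒰.biUnion 𝒱, ?_, ?_, ?_⟩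
    · calc _ ≤ 𝒰.card * C := Finset.card_biUnion_le_card_mul _ _ _ h1
        _ ≤ C ^ n * C := by gcongr
        _ = C ^ (n + 1) := (pow_succ _ _).symm
    · intro x hx
      obtain ⟨U, hU, hxU⟩ := mem_iUnion₂.1 (hcov hx)
      obtain ⟨V, hV, hxV⟩ := mem_iUnion₂.1 (h2 U hU hxU)
      exact mem_iUnion₂.2 ⟨V, Finset.mem_biUnion.2 ⟨U, hU, hV⟩, hxV⟩
    · intro V hV
      obtain ⟨U, hU, hV⟩ := Finset.mem_biUnion.1 hV
      calc Metric.ediam V ≤ Metric.ediam U / 2 := h3 U hU V hV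
        _ ≤ Metric.ediam A / 2 ^ n / 2 := by gcongr; exact hdiam U hU
        _ = Metric.ediam A / 2 ^ (n + 1) := by
          rw [pow_succ, div_eq_mul_inv, div_eq_mul_inv, div_eq_mul_inv,
            ENNReal.mul_inv (by simp) (by simp), mul_assoc]

/-- Separated sets have boundedly many points in balls of 100 times the separation, at all scales. -/
theorem IsDoublingSpace.exists_card_le (h : IsDoublingSpace X) :
    ∃ N : ℕ, 1 ≤ N ∧ ∀ (r : ℝ) (x : X) (F : Finset X), 0 < r →
      (F : Set X) ⊆ Metric.closedBall x (100 * r) →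
      (F : Set X).Pairwise (fun y z => r ≤ dist y z) → F.card ≤ N := by
  obtain ⟨C, hC⟩ := h.exists_finset_cover
  refine ⟨C ^ 8 + 1, by omega, fun r x F hr hF hsep => ?_⟩
  -- eight halvings bring the diameter `200 * r` of the ball below `r`
  obtain ⟨𝒰, hcard, hcov, hdiam⟩ := hC 8 (Metric.closedBall x (100 * r)) Metric.isBounded_closedBall
  have key : ∀ y ∈ F, ∃ U ∈ 𝒰, y ∈ U := fun y hy => by simpa using hcov (hF hy)
  choose! f hf hf' using key
  refine (Finset.card_le_card_of_injOn f hf ?_).trans (hcard.trans (by omega))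
  intro y hy z hz hyz
  by_contra hne
  have h1 : edist y z ≤ Metric.ediam (Metric.closedBall x (100 * r)) / 2 ^ 8 :=
    (Metric.edist_le_ediam_of_mem (hf' y hy) (hyz ▸ hf' z hz)).trans (hdiam _ (hf y hy))
  have h2 : Metric.ediam (Metric.closedBall x (100 * r)) ≤ ENNReal.ofReal (200 * r) := by
    refine Metric.ediam_le fun a ha b hb => ?_
    rw [edist_dist]
    refine ENNReal.ofReal_le_ofReal ?_
    have := dist_triangle_right a b x
    rw [Metric.mem_closedBall] at ha hb
    linarith
  have h3 : edist y z ≤ ENNReal.ofReal (200 * r / 2 ^ 8) := by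
    refine h1.trans ?_
    rw [ENNReal.ofReal_div_of_pos (by positivity)]
    gcongr
    rw [ENNReal.ofReal_pow (by norm_num)]
    simp
  rw [edist_dist, ENNReal.ofReal_le_ofReal_iff (by positivity)] at h3
  have := hsep hy hz hne
  norm_num at h3
  linarith

theorem IsDoublingSpace.properSpace [CompleteSpace X] (h : IsDoublingSpace X) : ProperSpace X := by
  obtain ⟨C, hC⟩ := h.exists_finset_cover
  refine ⟨fun x R => TotallyBounded.isCompact_of_isClosed ?_ Metric.isClosed_closedBall⟩
  refine Metric.totallyBounded_of_finite_discretization fun ε hε => ?_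
  have hfin : Metric.ediam (Metric.closedBall x R) ≠ ∞ :=
    Metric.isBounded_iff_ediam_ne_top.1 Metric.isBounded_closedBall
  have hlim : Filter.Tendsto (fun n : ℕ => Metric.ediam (Metric.closedBall x R) / 2 ^ n)
      Filter.atTop (nhds 0) := by
    have := ENNReal.Tendsto.const_mul (ENNReal.tendsto_pow_atTop_nhds_zero_of_lt_one
      (r := 2⁻¹) (by simp)) (Or.inr hfin)
    simpa [div_eq_mul_inv, ENNReal.inv_pow] using this
  obtain ⟨n, hn⟩ := (hlim.eventually (gt_mem_nhds (ENNReal.ofReal_pos.2 hε))).exists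
  obtain ⟨𝒰, -, hcov, hdiam⟩ := hC n (Metric.closedBall x R) Metric.isBounded_closedBall
  have key : ∀ y : Metric.closedBall x R, ∃ U : 𝒰, (y : X) ∈ (U : Set X) := fun y => by
    simpa using hcov y.2
  choose F hF using key
  refine ⟨𝒰, inferInstance, F, fun y z hyz => ?_⟩
  have : edist (y : X) z < ENNReal.ofReal ε :=
    ((Metric.edist_le_ediam_of_mem (hF y) (hyz ▸ hF z)).trans (hdiam _ (F y).2)).trans_lt hn
  rwa [edist_lt_ofReal] at this

end Doubling

/-! ### Trees of nets and their weights -/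

/-- The length scale `100 ^ (-k)` of generation `k`. -/
noncomputable def netScale (k : ℤ) : ℝ := (100 : ℝ) ^ (-k)

theorem netScale_pos (k : ℤ) : 0 < netScale k := by unfold netScale; positivity

theorem netScale_sub_one (k : ℤ) : netScale (k - 1) = 100 * netScale k := by
  unfold netScale
  rw [show -(k - 1) = -k + 1 by ring, zpow_add₀ (by norm_num)]
  ring

theorem netScale_natCast (n : ℕ) : netScale n = (1 / 100 : ℝ) ^ n := by
  simp [netScale]

/-- A hierarchy of nets in a metric space, one for each generation `k : ℤ`, organised into a tree.
The nets need not be nested; they only share the point `root`. Each point `y` regarded as a point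
of generation `k` has a `parent` in the net of generation `k - 1`, and each point `x` of
generation `k - 1` has a nearby point `center k x` in the net of generation `k`. The functions
`parent` and `center` are total: they are defined for all points of the space. -/
structure NetTree (X : Type*) [MetricSpace X] where
  net : ℤ → Set X
  root : X
  parent : ℤ → X → X
  center : ℤ → X → X
  /-- an upper bound for the number of points of a net in a ball of 100 times its scale -/
  bound : ℕ
  root_mem : ∀ k, root ∈ net k
  separated : ∀ k, (net k).Pairwise fun y z => netScale k ≤ dist y z
  parent_mem : ∀ k y, parent k y ∈ net (k - 1)
  dist_parent : ∀ k y, dist y (parent k y) < netScale (k - 1)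
  parent_eq : ∀ k y, ∀ x ∈ net (k - 1), dist x y ≤ netScale (k - 1) / 3 → parent k y = x
  center_mem : ∀ k x, center k x ∈ net k
  dist_center : ∀ k x, dist x (center k x) < netScale k
  one_le_bound : 1 ≤ bound
  card_le_bound : ∀ (k : ℤ) (x : X) (F : Finset X), (F : Set X) ⊆ net k →
    (F : Set X) ⊆ Metric.closedBall x (100 * netScale k) → F.card ≤ bound

theorem exists_maximal_separated {X : Type*} [MetricSpace X] (o : X) (r : ℝ) (hr : 0 < r) :
    ∃ s : Set X, o ∈ s ∧ (s.Pairwise fun y z => r ≤ dist y z) ∧ ∀ x, ∃ y ∈ s, dist x y < r := by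
  obtain ⟨s, hos, hs⟩ := zorn_subset_nonempty {s : Set X | s.Pairwise fun y z => r ≤ dist y z}
    (fun c hc hchain _ => ⟨⋃₀ c, (pairwise_sUnion hchain.directedOn).2 hc,
      fun s hs => subset_sUnion_of_mem hs⟩) {o} (by simp)
  refine ⟨s, hos rfl, hs.1, fun x => ?_⟩
  by_contra! hx
  have hins : (insert x s).Pairwise fun y z => r ≤ dist y z := by
    exact pairwise_insert.2 ⟨hs.1, fun y hy _ => ⟨hx y hy, dist_comm x y ▸ hx y hy⟩⟩
  have hxs : x ∈ s := hs.2 hins (subset_insert x s) (mem_insert x s)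
  have := hx x hxs
  rw [dist_self] at this
  linarith

theorem IsDoublingSpace.nonempty_netTree {X : Type*} [MetricSpace X] [Nonempty X]
    (h : IsDoublingSpace X) : Nonempty (NetTree X) := by
  classical
  obtain ⟨N, hN, hcard⟩ := h.exists_card_le
  obtain ⟨o⟩ := ‹Nonempty X›
  choose net ho hsep hcov using fun k : ℤ => exists_maximal_separated o (netScale k) (netScale_pos k)
  choose near hnear hdist using hcov
  let parent : ℤ → X → X := fun k y =>
    if h : ∃ x ∈ net (k - 1), dist x y ≤ netScale (k - 1) / 3 then h.choose else near (k - 1) y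
  refine ⟨⟨net, o, parent, near, N, ho, hsep, fun k y => ?_, fun k y => ?_, fun k y x hx hxy => ?_,
    hnear, hdist, hN, fun k x F hF hF' => hcard _ x F (netScale_pos k) hF' ((hsep k).mono hF)⟩⟩
  · by_cases h : ∃ x ∈ net (k - 1), dist x y ≤ netScale (k - 1) / 3
    · simpa only [parent, dif_pos h] using h.choose_spec.1
    · simpa only [parent, dif_neg h] using hnear (k - 1) y
  · by_cases h : ∃ x ∈ net (k - 1), dist x y ≤ netScale (k - 1) / 3
    · have h1 := h.choose_spec.2
      have h2 := netScale_pos (k - 1)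
      simp only [parent, dif_pos h]
      rw [dist_comm]
      linarith
    · simpa only [parent, dif_neg h] using hdist (k - 1) y
  · have h : ∃ x ∈ net (k - 1), dist x y ≤ netScale (k - 1) / 3 := ⟨x, hx, hxy⟩
    have h2 := netScale_pos (k - 1)
    simp only [parent, dif_pos h]
    by_contra hne
    have h3 := hsep (k - 1) h.choose_spec.1 hx hne
    have h4 := dist_triangle_right h.choose x y
    have h5 := h.choose_spec.2
    linarith

namespace NetTree

variable {X : Type*} [MetricSpace X] (T : NetTree X)

theorem parent_center (k : ℤ) {x : X} (hx : x ∈ T.net (k - 1)) : T.parent k (T.center k x) = x := by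
  refine T.parent_eq k _ x hx ?_
  have := T.dist_center k x
  have h2 := netScale_pos k
  rw [netScale_sub_one]
  linarith

theorem finite_net_inter [ProperSpace X] (k : ℤ) {B : Set X} (hB : Bornology.IsBounded B) :
    (T.net k ∩ B).Finite := by
  by_contra hinf
  obtain ⟨t, htf, ht⟩ := Metric.totallyBounded_iff.1
    (hB.isCompact_closure.totallyBounded.subset subset_closure) _ (half_pos (netScale_pos k))
  have key : ∀ y ∈ T.net k ∩ B, ∃ z ∈ t, dist y z < netScale k / 2 := fun y hy => by
    simpa using ht hy.2
  choose! f hf hf' using key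
  obtain ⟨y, hy, z, hz, hne, heq⟩ := Set.Infinite.exists_ne_map_eq_of_mapsTo hinf hf htf
  have h1 := T.separated k hy.1 hz.1 hne
  have h2 := hf' y hy
  have h3 := hf' z hz
  rw [← heq] at h3
  have := dist_triangle_right y z (f y)
  linarith

/-- The points of generation `k` with parent `x`. -/
def childSet (k : ℤ) (x : X) : Set X := {y ∈ T.net k | T.parent k y = x}

theorem finite_childSet [ProperSpace X] (k : ℤ) (x : X) : (T.childSet k x).Finite := by
  refine (T.finite_net_inter k (Metric.isBounded_closedBall (x := x) (r := netScale (k - 1)))).subset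
    fun y hy => ⟨hy.1, ?_⟩
  have := T.dist_parent k y
  rw [hy.2] at this
  exact this.le

/-- The finite set of points of generation `k` with parent `x`. -/
noncomputable def children [ProperSpace X] (k : ℤ) (x : X) : Finset X :=
  (T.finite_childSet k x).toFinset

theorem mem_children [ProperSpace X] {k : ℤ} {x y : X} :
    y ∈ T.children k x ↔ y ∈ T.net k ∧ T.parent k y = x := by
  simp [children, childSet]

theorem card_children_le [ProperSpace X] (k : ℤ) (x : X) : (T.children k x).card ≤ T.bound := by
  refine T.card_le_bound k x _ (fun y hy => (T.mem_children.1 hy).1) fun y hy => ?_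
  have := T.dist_parent k y
  rw [(T.mem_children.1 hy).2, netScale_sub_one] at this
  exact this.le

theorem center_mem_children [ProperSpace X] {k : ℤ} {x : X} (hx : x ∈ T.net (k - 1)) :
    T.center k x ∈ T.children k x :=
  T.mem_children.2 ⟨T.center_mem k x, T.parent_center k hx⟩

/-- A point of generation `k` is central if it is the center of its parent. -/
def IsCentral (k : ℤ) (y : X) : Prop := y = T.center k (T.parent k y)

/-- The ancestor of `y`, a point of generation `k`, in generation `k - n`. -/
def ancestor : ℕ → ℤ → X → X
  | 0, _, y => y
  | n + 1, k, y => ancestor n (k - 1) (T.parent k y)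

/-- The product of `f` over `y`, a point of generation `k`, and its ancestors in the generations
after `k - n`. -/
def ancestorProd (f : ℤ → X → ℝ≥0) : ℕ → ℤ → X → ℝ≥0
  | 0, _, _ => 1
  | n + 1, k, y => f k y * ancestorProd f n (k - 1) (T.parent k y)

theorem ancestor_succ' (n : ℕ) (k : ℤ) (y : X) :
    T.ancestor (n + 1) k y = T.parent (k - n) (T.ancestor n k y) := by
  induction n generalizing k y with
  | zero => simp [ancestor]
  | succ n ih =>
    rw [ancestor, ih, ← ancestor]
    congr 1
    push_cast
    ring

theorem ancestorProd_succ' (f : ℤ → X → ℝ≥0) (n : ℕ) (k : ℤ) (y : X) :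
    T.ancestorProd f (n + 1) k y = T.ancestorProd f n k y * f (k - n) (T.ancestor n k y) := by
  induction n generalizing k y with
  | zero => simp [ancestor, ancestorProd]
  | succ n ih =>
    rw [ancestorProd, ih, ← mul_assoc, ← ancestorProd, ← ancestor]
    congr 2
    push_cast
    ring

theorem ancestor_mem {n : ℕ} {k : ℤ} {y : X} (hy : y ∈ T.net k) :
    T.ancestor n k y ∈ T.net (k - n) := by
  cases n with
  | zero => simpa [ancestor] using hy
  | succ n =>
    rw [ancestor_succ']
    convert T.parent_mem (k - n) _ using 2
    push_cast
    ring

theorem dist_ancestor_le (n : ℕ) (k : ℤ) (y : X) :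
    dist y (T.ancestor n k y) ≤ 2 * netScale (k - n) - 2 * netScale k := by
  induction n generalizing k y with
  | zero => simp [ancestor]
  | succ n ih =>
    have h1 := ih (k - 1) (T.parent k y)
    have h2 := T.dist_parent k y
    have h3 := dist_triangle y (T.parent k y) (T.ancestor (n + 1) k y)
    have h4 := netScale_sub_one k
    have h5 := netScale_pos k
    rw [ancestor] at h3 ⊢
    rw [show k - 1 - (n : ℤ) = k - ((n + 1 : ℕ) : ℤ) by push_cast; ring] at h1
    linarith

theorem dist_ancestor_le' (n : ℕ) (k : ℤ) (y : X) :
    dist y (T.ancestor n k y) ≤ 2 * netScale (k - n) :=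
  (T.dist_ancestor_le n k y).trans (by linarith [netScale_pos k])

/-- Any two points have a common ancestor, namely `root` in a sufficiently early generation. -/
theorem exists_ancestor_eq_root (k : ℤ) (y : X) : ∃ n, T.ancestor n k y = T.root := by
  have hlim : Filter.Tendsto (fun n : ℕ => netScale k * (100 : ℝ) ^ n) Filter.atTop Filter.atTop :=
    (tendsto_pow_atTop_atTop_of_one_lt (by norm_num)).const_mul_atTop (netScale_pos k)
  obtain ⟨n, hn⟩ := (hlim.eventually_ge_atTop (dist T.root y)).exists
  refine ⟨n + 1, ?_⟩
  rw [ancestor_succ']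
  refine T.parent_eq _ _ _ (T.root_mem _) ?_
  have h1 := T.dist_ancestor_le' n k y
  have h2 : netScale (k - n) = netScale k * (100 : ℝ) ^ n := by
    simp only [netScale]
    rw [show -(k - (n : ℤ)) = -k + n by ring, zpow_add₀ (by norm_num), zpow_natCast]
  have h3 := dist_triangle T.root y (T.ancestor n k y)
  rw [netScale_sub_one]
  have h4 := netScale_pos (k - n)
  linarith

theorem parent_root (k : ℤ) : T.parent k T.root = T.root :=
  T.parent_eq k _ _ (T.root_mem _) (by rw [dist_self]; linarith [netScale_pos (k - 1)])

theorem ancestor_eq_root_of_le {n m : ℕ} {k : ℤ} {y : X} (h : T.ancestor n k y = T.root)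
    (hnm : n ≤ m) : T.ancestor m k y = T.root := by
  induction m, hnm using Nat.le_induction with
  | base => exact h
  | succ m _ ih => rw [ancestor_succ', ih, parent_root]

end NetTree

namespace NetTree

variable {X : Type*} [MetricSpace X] (T : NetTree X)

/-- The factor by which the size of a noncentral point is smaller than the size of its parent. It is
so small that the noncentral children of a point have total size at most half that of the point. -/
noncomputable def eta : ℝ≥0 := 1 / (2 * T.bound)

theorem bound_mul_eta : T.bound * T.eta = 1 / 2 := by
  have : (T.bound : ℝ≥0) ≠ 0 := by exact_mod_cast (Nat.one_le_iff_ne_zero.1 T.one_le_bound)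
  unfold eta
  field_simp

theorem eta_pos : 0 < T.eta := by
  have : (0 : ℝ≥0) < T.bound := by exact_mod_cast T.one_le_bound
  unfold eta
  positivity

theorem eta_le_half : T.eta ≤ 1 / 2 := by
  rw [← T.bound_mul_eta]
  exact le_mul_of_one_le_left zero_le (by exact_mod_cast T.one_le_bound)

theorem card_mul_eta_sq_le {n : ℕ} (hn : n ≤ T.bound) : n * T.eta ^ 2 ≤ 1 / 4 := by
  calc n * T.eta ^ 2 ≤ T.bound * T.eta ^ 2 := by gcongr
    _ = (T.bound * T.eta) * T.eta := by ring
    _ ≤ (1 / 2) * (1 / 2) := by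
      rw [T.bound_mul_eta]
      gcongr
      exact T.eta_le_half
    _ = 1 / 4 := by norm_num

open Classical in
/-- The ratio of the sizes of a point and of its parent. The size is a potential whose square
dominates the mass. -/
noncomputable def sizeRatio (k : ℤ) (y : X) : ℝ≥0 := if T.IsCentral k y then 1 else T.eta

theorem sizeRatio_of_not_isCentral {k : ℤ} {y : X} (h : ¬ T.IsCentral k y) :
    T.sizeRatio k y = T.eta := if_neg h

theorem sizeRatio_le_one (k : ℤ) (y : X) : T.sizeRatio k y ≤ 1 := by
  unfold sizeRatio
  split_ifs
  · exact le_rfl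
  · exact T.eta_le_half.trans (by norm_num)

theorem isCentral_center {k : ℤ} {x : X} (hx : x ∈ T.net (k - 1)) :
    T.IsCentral k (T.center k x) := by
  rw [IsCentral, T.parent_center k hx]

/-- Two nearby points with different parents are both noncentral, as a central point is deep inside
the region belonging to its parent. -/
theorem not_isCentral_of_parent_ne {k : ℤ} {p q : X} (hpq : dist p q ≤ 16 * netScale k)
    (h : T.parent k p ≠ T.parent k q) : ¬ T.IsCentral k p := by
  intro hc
  refine h (T.parent_eq k q _ (T.parent_mem k p) ?_).symm
  have h1 := T.dist_center k (T.parent k p)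
  rw [← hc] at h1
  have h2 := dist_triangle (T.parent k p) p q
  have h3 := netScale_pos k
  rw [netScale_sub_one]
  linarith

section Weights

variable [ProperSpace X]

open Classical in
/-- The ratio of the masses of a point and of its parent: every noncentral child receives the
small fraction `eta ^ 2` of the mass, the central child receives the rest. -/
noncomputable def massRatio (k : ℤ) (y : X) : ℝ≥0 :=
  if T.IsCentral k y then 1 - ((T.children k (T.parent k y)).card - 1 : ℕ) * T.eta ^ 2
  else T.eta ^ 2

theorem massRatio_of_not_isCentral {k : ℤ} {y : X} (h : ¬ T.IsCentral k y) :
    T.massRatio k y = T.eta ^ 2 := if_neg h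

theorem massRatio_le_sizeRatio_sq (k : ℤ) (y : X) : T.massRatio k y ≤ T.sizeRatio k y ^ 2 := by
  unfold massRatio sizeRatio
  split_ifs
  · simp
  · exact le_rfl

theorem massRatio_le_one (k : ℤ) (y : X) : T.massRatio k y ≤ 1 :=
  (T.massRatio_le_sizeRatio_sq k y).trans (pow_le_one' (T.sizeRatio_le_one k y) 2)

theorem eta_sq_le_massRatio (k : ℤ) (y : X) : T.eta ^ 2 ≤ T.massRatio k y := by
  unfold massRatio
  split_ifs
  · refine le_tsub_of_add_le_left ?_
    have h1 := T.card_mul_eta_sq_le (n := (T.children k (T.parent k y)).card - 1)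
      ((Nat.sub_le _ _).trans (T.card_children_le _ _))
    have h2 : T.eta ^ 2 ≤ 1 / 4 := by
      simpa using T.card_mul_eta_sq_le (n := 1) T.one_le_bound
    calc _ ≤ (1 / 4 : ℝ≥0) + 1 / 4 := add_le_add h1 h2
      _ ≤ 1 := by rw [← NNReal.coe_le_coe]; norm_num
  · exact le_rfl

theorem massRatio_pos (k : ℤ) (y : X) : 0 < T.massRatio k y :=
  (pow_pos T.eta_pos 2).trans_le (T.eta_sq_le_massRatio k y)

theorem not_isCentral_of_mem_erase [DecidableEq X] {k : ℤ} {x y : X}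
    (hy : y ∈ (T.children k x).erase (T.center k x)) : ¬ T.IsCentral k y := by
  rw [Finset.mem_erase, mem_children] at hy
  rw [IsCentral, hy.2.2]
  exact hy.1

theorem sum_massRatio {k : ℤ} {x : X} (hx : x ∈ T.net (k - 1)) :
    ∑ y ∈ T.children k x, T.massRatio k y = 1 := by
  classical
  rw [← Finset.add_sum_erase _ _ (T.center_mem_children hx),
    Finset.sum_congr rfl fun y hy =>
      T.massRatio_of_not_isCentral (T.not_isCentral_of_mem_erase hy),
    Finset.sum_const, Finset.card_erase_of_mem (T.center_mem_children hx), nsmul_eq_mul,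
    massRatio, if_pos (T.isCentral_center hx), T.parent_center k hx]
  refine tsub_add_cancel_of_le ((T.card_mul_eta_sq_le ((Nat.sub_le _ _).trans
    (T.card_children_le _ _))).trans ?_)
  rw [← NNReal.coe_le_coe]; norm_num

theorem sum_sizeRatio_le {k : ℤ} {x : X} (hx : x ∈ T.net (k - 1)) :
    ∑ y ∈ T.children k x, T.sizeRatio k y ≤ 3 / 2 := by
  classical
  rw [← Finset.add_sum_erase _ _ (T.center_mem_children hx),
    Finset.sum_congr rfl fun y hy =>
      T.sizeRatio_of_not_isCentral (T.not_isCentral_of_mem_erase hy),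
    Finset.sum_const, nsmul_eq_mul, sizeRatio, if_pos (T.isCentral_center hx)]
  have h1 : (((T.children k x).erase (T.center k x)).card : ℝ≥0) * T.eta ≤ 1 / 2 := by
    rw [← T.bound_mul_eta]
    gcongr
    exact (Finset.card_erase_le).trans (T.card_children_le _ _)
  calc _ ≤ (1 : ℝ≥0) + 1 / 2 := by gcongr
    _ = 3 / 2 := by rw [← NNReal.coe_inj]; norm_num

/-- A product of the values of `v`, going in both directions from `0`. -/
theorem exists_pos_forall_eq_mul (v : ℤ → ℝ≥0) (hv : ∀ k, 0 < v k) :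
    ∃ M : ℤ → ℝ≥0, (∀ k, 0 < M k) ∧ ∀ k, M k = v k * M (k - 1) := by
  refine ⟨fun k => (∏ i ∈ Finset.Ioc 0 k, v i) / ∏ i ∈ Finset.Ioc k 0, v i, fun k => ?_,
    fun k => ?_⟩
  · exact div_pos (Finset.prod_pos fun i _ => hv i) (Finset.prod_pos fun i _ => hv i)
  · rcases le_or_gt k 0 with hk | hk
    · have h1 : Finset.Ioc (k - 1) 0 = insert k (Finset.Ioc k 0) := by ext; simp; omega
      have := (hv k).ne'
      simp only [h1, Finset.Ioc_eq_empty_of_le hk,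
        Finset.Ioc_eq_empty_of_le (show k - 1 ≤ 0 by omega)]
      rw [Finset.prod_insert (by simp)]
      have := (Finset.prod_pos fun i (_ : i ∈ Finset.Ioc k 0) => hv i).ne'
      field_simp
    · have h1 : Finset.Ioc 0 k = insert k (Finset.Ioc 0 (k - 1)) := by ext; simp; omega
      simp only [h1, Finset.Ioc_eq_empty_of_le hk.le,
        Finset.Ioc_eq_empty_of_le (show 0 ≤ k - 1 by omega)]
      rw [Finset.prod_insert (by simp)]
      simp

/-- There are masses with the prescribed ratios, although the tree has no first generation: the mass
of a point is computed from that of the root in an early generation, and the masses of the root are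
found by going in both directions from generation `0`. -/
theorem exists_mass : ∃ m : ℤ → X → ℝ≥0, (∀ k y, 0 < m k y) ∧
    ∀ k y, m k y = T.massRatio k y * m (k - 1) (T.parent k y) := by
  obtain ⟨M, hM, hMr⟩ := exists_pos_forall_eq_mul (fun k => T.massRatio k T.root)
    fun k => T.massRatio_pos k _
  -- the mass of `y` computed from the mass `M (k - n)` of the root, if the root is an ancestor of `y`
  let Q : ℕ → ℤ → X → ℝ≥0 := fun n k y => T.ancestorProd T.massRatio n k y * M (k - n)
  have hQ : ∀ n m k y, T.ancestor n k y = T.root → n ≤ m → Q m k y = Q n k y := by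
    intro n m k y hn hnm
    induction m, hnm using Nat.le_induction with
    | base => rfl
    | succ m hm ih =>
      rw [← ih]
      simp only [Q]
      rw [ancestorProd_succ', T.ancestor_eq_root_of_le hn hm, hMr (k - m), mul_assoc]
      congr 3
      push_cast
      ring
  choose n hn using T.exists_ancestor_eq_root
  have hpos : ∀ n k y, 0 < T.ancestorProd T.massRatio n k y := by
    intro n
    induction n with
    | zero => exact fun _ _ => one_pos
    | succ n ih => exact fun k y => mul_pos (T.massRatio_pos k y) (ih _ _)
  refine ⟨fun k y => Q (n k y) k y, fun k y => mul_pos (hpos _ _ _) (hM _), fun k y => ?_⟩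
  dsimp only
  rw [← hQ _ _ _ _ (hn k y) (le_max_left _ (n (k - 1) (T.parent k y) + 1)),
    ← hQ _ _ _ _ (hn (k - 1) (T.parent k y))
      (show _ ≤ max (n k y) (n (k - 1) (T.parent k y) + 1) - 1 by omega)]
  obtain ⟨j, hj⟩ : ∃ j, max (n k y) (n (k - 1) (T.parent k y) + 1) = j + 1 := ⟨_, by
    rw [Nat.sub_add_cancel]; omega⟩
  rw [hj, Nat.add_sub_cancel]
  simp only [Q]
  rw [ancestorProd, mul_assoc]
  congr 3
  push_cast
  ring

/-- The mass of a point of generation `k`. It is the limit mass of the set of all its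
descendants. -/
noncomputable def mass : ℤ → X → ℝ≥0 := T.exists_mass.choose

theorem mass_pos (k : ℤ) (y : X) : 0 < T.mass k y := T.exists_mass.choose_spec.1 k y

theorem mass_eq (k : ℤ) (y : X) : T.mass k y = T.massRatio k y * T.mass (k - 1) (T.parent k y) :=
  T.exists_mass.choose_spec.2 k y

theorem mass_le_mass_parent (k : ℤ) (y : X) : T.mass k y ≤ T.mass (k - 1) (T.parent k y) := by
  rw [mass_eq]
  exact mul_le_of_le_one_left zero_le (T.massRatio_le_one k y)

theorem eta_sq_mul_mass_parent_le (k : ℤ) (y : X) :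
    T.eta ^ 2 * T.mass (k - 1) (T.parent k y) ≤ T.mass k y := by
  rw [T.mass_eq k y]
  gcongr
  exact T.eta_sq_le_massRatio k y

/-- Nearby points of the same generation have comparable masses: going up the tree, as long as the
ancestors of the two points differ, both masses change by the same factor `eta ^ 2`. -/
theorem eta_sq_mul_mass_le_mass {k : ℤ} {p q : X} (hpq : dist p q ≤ 16 * netScale k) :
    T.eta ^ 2 * T.mass k p ≤ T.mass k q := by
  obtain ⟨n, hn⟩ := T.exists_ancestor_eq_root k p
  obtain ⟨n', hn'⟩ := T.exists_ancestor_eq_root k q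
  have h : T.ancestor (max n n') k p = T.ancestor (max n n') k q := by
    rw [T.ancestor_eq_root_of_le hn (le_max_left _ _),
      T.ancestor_eq_root_of_le hn' (le_max_right _ _)]
  generalize max n n' = j at h
  clear hn hn'
  induction j generalizing k p q with
  | zero =>
    rw [show p = q from h]
    exact mul_le_of_le_one_left zero_le (pow_le_one' (T.eta_le_half.trans (by norm_num)) 2)
  | succ j ih =>
    by_cases hpar : T.parent k p = T.parent k q
    · calc _ ≤ T.eta ^ 2 * T.mass (k - 1) (T.parent k p) := by
            gcongr
            exact T.mass_le_mass_parent k p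
        _ ≤ T.mass k q := hpar ▸ T.eta_sq_mul_mass_parent_le k q
    · have hp := T.not_isCentral_of_parent_ne hpq hpar
      have hq := T.not_isCentral_of_parent_ne (dist_comm p q ▸ hpq) (Ne.symm hpar)
      rw [T.mass_eq k p, T.mass_eq k q, T.massRatio_of_not_isCentral hp,
        T.massRatio_of_not_isCentral hq]
      gcongr
      refine ih ?_ h
      -- the parents are at distance at most `(16 + 2 * 100) * netScale k ≤ 16 * netScale (k - 1)`
      have h1 := T.dist_parent k p
      have h2 := T.dist_parent k q
      have h3 := dist_triangle4 (T.parent k p) p q (T.parent k q)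
      rw [dist_comm _ p] at h3
      rw [netScale_sub_one] at h1 h2 ⊢
      linarith [netScale_pos k]

theorem mass_eq_ancestorProd (n : ℕ) (k : ℤ) (y : X) :
    T.mass k y = T.ancestorProd T.massRatio n k y * T.mass (k - n) (T.ancestor n k y) := by
  induction n generalizing k y with
  | zero => simp [ancestorProd, ancestor]
  | succ n ih =>
    rw [ancestorProd, ancestor, T.mass_eq k y, ih (k - 1), mul_assoc]
    congr 3
    push_cast
    ring

theorem ancestorProd_massRatio_le (n : ℕ) (k : ℤ) (y : X) :
    T.ancestorProd T.massRatio n k y ≤ T.ancestorProd T.sizeRatio n k y ^ 2 := by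
  induction n generalizing k y with
  | zero => simp [ancestorProd]
  | succ n ih =>
    rw [ancestorProd, ancestorProd, mul_pow]
    gcongr
    · exact T.massRatio_le_sizeRatio_sq k y
    · exact ih _ _

/-! ### Sums over generations -/

/-- A sum over generation `k`, arranged by parents. -/
theorem tsum_net_eq (k : ℤ) (a : X → ℝ≥0) (g : X → ℝ≥0∞) :
    ∑' y, (T.net k).indicator (fun y => a y * g (T.parent k y)) y =
      ∑' x, (T.net (k - 1)).indicator
        (fun x => ((∑ y ∈ T.children k x, a y : ℝ≥0) : ℝ≥0∞) * g x) x := by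
  classical
  calc _ = ∑' y, ∑' x, (if y ∈ T.net k ∧ T.parent k y = x then a y * g x else 0 : ℝ≥0∞) := by
        refine tsum_congr fun y => ?_
        rw [tsum_eq_single (T.parent k y) fun x hx => if_neg fun h => hx h.2.symm]
        simp [indicator]
    _ = ∑' x, ∑' y, (if y ∈ T.net k ∧ T.parent k y = x then a y * g x else 0 : ℝ≥0∞) :=
        ENNReal.tsum_comm
    _ = _ := by
        refine tsum_congr fun x => ?_
        rw [tsum_eq_sum (s := T.children k x) fun y hy => if_neg fun h => hy (T.mem_children.2 h),
          Finset.sum_congr rfl fun y hy => if_pos (T.mem_children.1 hy), ← Finset.sum_mul]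
        by_cases hx : x ∈ T.net (k - 1)
        · rw [indicator_of_mem hx, ENNReal.ofNNReal_finsetSum]
        · have : T.children k x = ∅ := by
            refine Finset.eq_empty_of_forall_notMem fun y hy => hx ?_
            rw [← (T.mem_children.1 hy).2]
            exact T.parent_mem k y
          simp [this, hx]

/-- Conservation of mass: summing a function of the `n`-fold ancestor over generation `k` amounts to
summing the function over generation `k - n`. -/
theorem tsum_mass_ancestor (n : ℕ) (k : ℤ) (g : X → ℝ≥0∞) :
    ∑' y, (T.net k).indicator (fun y => T.mass k y * g (T.ancestor n k y)) y =
      ∑' x, (T.net (k - n)).indicator (fun x => T.mass (k - n) x * g x) x := by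
  induction n generalizing k with
  | zero => simp [ancestor]
  | succ n ih =>
    have h1 := ih (k - 1)
    rw [show k - 1 - (n : ℤ) = k - ((n + 1 : ℕ) : ℤ) by push_cast; ring] at h1
    rw [← h1]
    have h2 := T.tsum_net_eq k (T.massRatio k)
      (fun x => T.mass (k - 1) x * g (T.ancestor n (k - 1) x))
    calc _ = _ := by
          refine Eq.trans (tsum_congr fun y => ?_) h2
          congr 1
          ext y
          rw [T.mass_eq k y, ancestor, ENNReal.coe_mul, mul_assoc]
      _ = _ := by
          refine tsum_congr fun x => congrFun (indicator_congr fun x hx => ?_) x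
          rw [T.sum_massRatio hx, ENNReal.coe_one, one_mul]

theorem tsum_size_ancestor_le (n : ℕ) (k : ℤ) (g : X → ℝ≥0∞) :
    ∑' y, (T.net k).indicator
        (fun y => T.ancestorProd T.sizeRatio n k y * g (T.ancestor n k y)) y ≤
      (3 / 2) ^ n * ∑' x, (T.net (k - n)).indicator g x := by
  induction n generalizing k with
  | zero => simp [ancestor, ancestorProd]
  | succ n ih =>
    have h1 := ih (k - 1)
    rw [show k - 1 - (n : ℤ) = k - ((n + 1 : ℕ) : ℤ) by push_cast; ring] at h1
    have h2 := T.tsum_net_eq k (T.sizeRatio k)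
      (fun x => T.ancestorProd T.sizeRatio n (k - 1) x * g (T.ancestor n (k - 1) x))
    calc _ = _ := by
          refine Eq.trans (tsum_congr fun y => ?_) h2
          congr 1
          ext y
          rw [ancestorProd, ancestor, ENNReal.coe_mul, mul_assoc]
      _ ≤ ∑' x, (3 / 2) * (T.net (k - 1)).indicator (fun x =>
            (T.ancestorProd T.sizeRatio n (k - 1) x : ℝ≥0∞) * g (T.ancestor n (k - 1) x)) x := by
          refine ENNReal.tsum_le_tsum fun x => ?_
          by_cases hx : x ∈ T.net (k - 1)
          · rw [indicator_of_mem hx, indicator_of_mem hx]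
            gcongr
            have := ENNReal.coe_le_coe.2 (T.sum_sizeRatio_le hx)
            rwa [ENNReal.coe_div (by norm_num)] at this
          · simp [hx]
      _ ≤ (3 / 2) * ((3 / 2) ^ n *
            ∑' x, (T.net (k - ((n + 1 : ℕ) : ℤ))).indicator g x) := by
          rw [ENNReal.tsum_mul_left]
          gcongr
      _ = _ := by rw [pow_succ']; ring

end Weights

end NetTree

/-! ### Vague limits of measures -/

section VagueLimit

open Filter Topology
open scoped CompactlySupported

variable {X : Type*} [TopologicalSpace X] [MeasurableSpace X] [BorelSpace X]

theorem ofReal_integral_le_measure (μ : Measure X) [IsFiniteMeasureOnCompacts μ] {f : C_c(X, ℝ)}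
    (hf : ∀ x, 0 ≤ f x ∧ f x ≤ 1) {U : Set X} (hU : tsupport f ⊆ U) :
    ENNReal.ofReal (∫ x, f x ∂μ) ≤ μ U := by
  rw [ofReal_integral_eq_lintegral_ofReal f.integrable (Eventually.of_forall fun x => (hf x).1)]
  refine le_trans ?_ (measure_mono hU)
  rw [← lintegral_indicator_one (isClosed_tsupport f).measurableSet]
  refine lintegral_mono fun x => ?_
  by_cases hx : x ∈ tsupport f
  · rw [indicator_of_mem hx]
    exact ENNReal.ofReal_le_one.2 (hf x).2
  · simp [image_eq_zero_of_notMem_tsupport hx]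

theorem measure_le_ofReal_integral [T2Space X] (μ : Measure X) [IsFiniteMeasureOnCompacts μ]
    {f : C_c(X, ℝ)}
    (hf : ∀ x, 0 ≤ f x) {K : Set X} (hK : IsCompact K) (hfK : ∀ x ∈ K, f x = 1) :
    μ K ≤ ENNReal.ofReal (∫ x, f x ∂μ) := by
  rw [ofReal_integral_eq_lintegral_ofReal f.integrable (Eventually.of_forall hf),
    ← lintegral_indicator_one hK.measurableSet]
  refine lintegral_mono fun x => ?_
  by_cases hx : x ∈ K
  · simp [hx, hfK x hx]
  · simp [hx]

/-- A locally bounded sequence of measures has a vague limit point `ν`. Only the inequalities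
between `ν` and the sequence on open and on compact sets are recorded. The limit is
taken along an ultrafilter, and `ν` comes from the Riesz–Markov–Kakutani theorem. -/
theorem exists_vague_limit [T2Space X] [LocallyCompactSpace X] (μ : ℕ → Measure X)
    (hμ : ∀ K, IsCompact K → ∃ C : ℝ≥0, ∀ n, μ n K ≤ C) :
    ∃ ν : Measure X,
      (∀ U, IsOpen U → ∀ a : ℝ≥0∞, (∀ᶠ n in atTop, μ n U ≤ a) → ν U ≤ a) ∧
      ∀ K U, IsCompact K → IsOpen U → K ⊆ U →
        ∀ a : ℝ≥0∞, (∀ᶠ n in atTop, a ≤ μ n K) → a ≤ ν U := by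
  have hfin : ∀ n, IsFiniteMeasureOnCompacts (μ n) := fun n => ⟨fun K hK => by
    obtain ⟨C, hC⟩ := hμ K hK
    exact (hC n).trans_lt ENNReal.coe_lt_top⟩
  have hlim : ∀ f : C_c(X, ℝ), ∃ L : ℝ,
      Tendsto (fun n => ∫ x, f x ∂(μ n)) (hyperfilter ℕ : Filter ℕ) (𝓝 L) := by
    intro f
    obtain ⟨C, hC⟩ := hμ _ f.hasCompactSupport
    obtain ⟨B, hB⟩ := f.hasCompactSupport.exists_bound_of_continuous f.continuous
    have hB0 : 0 ≤ max B 0 := le_max_right _ _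
    have hmem : ∀ n, ∫ x, f x ∂(μ n) ∈ Icc (-(max B 0 * C)) (max B 0 * C) := by
      intro n
      rw [mem_Icc, ← abs_le, ← Real.norm_eq_abs, ← setIntegral_eq_integral_of_forall_compl_eq_zero
        (s := tsupport f) fun x hx => image_eq_zero_of_notMem_tsupport hx]
      have hlt : μ n (tsupport f) < ∞ := (hC n).trans_lt ENNReal.coe_lt_top
      refine (norm_setIntegral_le_of_norm_le_const (C := max B 0) hlt
        fun x _ => (hB x).trans (le_max_left _ _)).trans ?_
      gcongr
      exact ENNReal.toReal_le_of_le_ofReal C.2 (by simpa using hC n)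
    obtain ⟨L, -, hL⟩ := isCompact_Icc.ultrafilter_le_nhds
      ((hyperfilter ℕ).map fun n => ∫ x, f x ∂(μ n))
      (le_principal_iff.2 (Eventually.of_forall hmem : ∀ᶠ n in (hyperfilter ℕ : Filter ℕ), _))
    exact ⟨L, hL⟩
  choose L hL using hlim
  let Λ : C_c(X, ℝ) →ₚ[ℝ] ℝ := PositiveLinearMap.mk₀
    { toFun := L
      map_add' := fun f g => by
        refine tendsto_nhds_unique (hL _) (((hL f).add (hL g)).congr fun n => ?_)
        exact (integral_add f.integrable g.integrable).symm
      map_smul' := fun c f => by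
        refine tendsto_nhds_unique (hL _) (((hL f).const_mul c).congr fun n => ?_)
        exact (integral_const_mul c f).symm }
    fun f hf => ge_of_tendsto' (hL f) fun n => integral_nonneg hf
  have hle : (hyperfilter ℕ : Filter ℕ) ≤ atTop := Nat.hyperfilter_le_atTop
  refine ⟨RealRMK.rieszMeasure Λ, fun U hU a ha => ?_, fun K U hK hU hKU a ha => ?_⟩
  · rw [hU.measure_eq_iSup_isCompact]
    refine iSup₂_le fun K hKU => iSup_le fun hK => ?_
    obtain ⟨g, hf1, hgc, hfU, hf⟩ := exists_continuousMap_one_of_isCompact_subset_isOpen hK hU hKU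
    let f : C_c(X, ℝ) := ⟨g, hgc⟩
    refine (RealRMK.rieszMeasure_le_of_eq_one Λ (f := f) (fun x => (hf x).1) hK hf1).trans ?_
    refine le_of_tendsto (ENNReal.tendsto_ofReal (hL f)) ?_
    filter_upwards [hle ha] with n hn
    exact (ofReal_integral_le_measure (μ n) (f := f) hf hfU).trans hn
  · obtain ⟨g, hf1, hgc, hfU, hf⟩ := exists_continuousMap_one_of_isCompact_subset_isOpen hK hU hKU
    let f : C_c(X, ℝ) := ⟨g, hgc⟩
    refine le_trans ?_ (RealRMK.le_rieszMeasure_tsupport_subset Λ (f := f) hf hfU)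
    refine ge_of_tendsto (ENNReal.tendsto_ofReal (hL f)) ?_
    filter_upwards [hle ha] with n hn
    exact hn.trans (measure_le_ofReal_integral (μ n) (f := f) (fun x => (hf x).1) hK hf1)

end VagueLimit

/-! ### The limit of the masses of the nets -/

namespace NetTree

variable {X : Type*} [MetricSpace X] (T : NetTree X) [ProperSpace X] [MeasurableSpace X]

/-- The discrete measure formed by the masses of the points of generation `k`. -/
noncomputable def netMeasure (k : ℤ) : Measure X :=
  Measure.sum fun y => (T.net k).indicator (fun y => (T.mass k y : ℝ≥0∞)) y • Measure.dirac y

theorem netMeasure_apply (k : ℤ) {S : Set X} (hS : MeasurableSet S) :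
    T.netMeasure k S =
      ∑' y, (T.net k).indicator (fun y => T.mass k y * S.indicator (1 : X → ℝ≥0∞) y) y := by
  rw [netMeasure, Measure.sum_apply _ hS]
  refine tsum_congr fun y => ?_
  rw [Measure.smul_apply, Measure.dirac_apply' _ hS, smul_eq_mul, indicator_mul_left]

theorem netMeasure_le_of_ancestor_mem (n : ℕ) (k : ℤ) {S S' : Set X} (hS : MeasurableSet S)
    (hS' : MeasurableSet S') (h : ∀ y ∈ S, T.ancestor n k y ∈ S') :
    T.netMeasure k S ≤ T.netMeasure (k - n) S' := by
  rw [T.netMeasure_apply k hS, T.netMeasure_apply (k - n) hS', ← T.tsum_mass_ancestor]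
  refine ENNReal.tsum_le_tsum fun y => indicator_le_indicator ?_
  gcongr
  by_cases hy : y ∈ S
  · simp [hy, h y hy]
  · simp [hy]

theorem mass_le_netMeasure (n : ℕ) (k : ℤ) {S : Set X} (hS : MeasurableSet S) {p : X}
    (hp : p ∈ T.net (k - n)) (h : ∀ y, T.ancestor n k y = p → y ∈ S) :
    T.mass (k - n) p ≤ T.netMeasure k S := by
  rw [T.netMeasure_apply k hS]
  calc (T.mass (k - n) p : ℝ≥0∞) = ∑' x, (T.net (k - n)).indicator
        (fun x => T.mass (k - n) x * ({p} : Set X).indicator (1 : X → ℝ≥0∞) x) x := by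
        rw [tsum_eq_single p fun x hx => by simp [indicator, hx]]
        simp [hp]
    _ ≤ _ := by
        rw [← T.tsum_mass_ancestor]
        refine ENNReal.tsum_le_tsum fun y => indicator_le_indicator ?_
        gcongr
        by_cases hy : T.ancestor n k y = p
        · simp [hy, h y hy]
        · simp [hy]

theorem netMeasure_le_card_mul (k : ℤ) {S : Set X} (hS : MeasurableSet S) (F : Finset X)
    (hF : T.net k ∩ S ⊆ F) {a : ℝ≥0} (ha : ∀ y ∈ F, T.mass k y ≤ a) :
    T.netMeasure k S ≤ F.card * a := by
  rw [T.netMeasure_apply k hS, tsum_eq_sum (s := F) fun y hy => ?_, ← nsmul_eq_mul]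
  · refine Finset.sum_le_card_nsmul _ _ _ fun y hy => ?_
    refine (indicator_le_self _ _ _).trans (le_trans ?_ (ENNReal.coe_le_coe.2 (ha y hy)))
    exact mul_le_of_le_one_right' (indicator_le_self' (by simp) y)
  · by_cases h : y ∈ T.net k
    · have : y ∉ S := fun hyS => hy (hF ⟨h, hyS⟩)
      simp [this]
    · simp [h]

theorem netMeasure_lt_top (k : ℤ) {S : Set X} (hS : MeasurableSet S)
    (hb : Bornology.IsBounded S) : T.netMeasure k S < ∞ := by
  have hfin := T.finite_net_inter k hb
  refine (T.netMeasure_le_card_mul k hS hfin.toFinset (by simp)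
    (a := hfin.toFinset.sup (T.mass k)) fun y hy => Finset.le_sup hy).trans_lt ?_
  exact ENNReal.mul_lt_top (by simp) ENNReal.coe_lt_top

variable [BorelSpace X]

theorem netMeasure_closedBall_le (n : ℕ) (k : ℤ) (x : X) (R : ℝ) :
    T.netMeasure k (Metric.closedBall x R) ≤
      T.netMeasure (k - n) (Metric.closedBall x (R + 2 * netScale (k - n))) := by
  refine T.netMeasure_le_of_ancestor_mem n k Metric.isClosed_closedBall.measurableSet
    Metric.isClosed_closedBall.measurableSet fun y hy => ?_
  rw [Metric.mem_closedBall] at *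
  have := dist_triangle_left (T.ancestor n k y) x y
  linarith [T.dist_ancestor_le' n k y]

theorem exists_netMeasure_le {K : Set X} (hK : IsCompact K) :
    ∃ C : ℝ≥0, ∀ n : ℕ, T.netMeasure n K ≤ C := by
  obtain ⟨R, hR⟩ := hK.isBounded.subset_closedBall T.root
  have hlt := T.netMeasure_lt_top 0 Metric.isClosed_closedBall.measurableSet
    (Metric.isBounded_closedBall (x := T.root) (r := R + 2 * netScale 0))
  refine ⟨_, fun n => ((measure_mono hR).trans ?_).trans_eq (ENNReal.coe_toNNReal hlt.ne).symm⟩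
  simpa using T.netMeasure_closedBall_le n n T.root R

/-- A measure with the properties of the vague limit of the measures `netMeasure`. -/
noncomputable def limitMeasure : Measure X :=
  (exists_vague_limit (fun n : ℕ => T.netMeasure n) fun _ hK => T.exists_netMeasure_le hK).choose

theorem limitMeasure_le {U : Set X} (hU : IsOpen U) {a : ℝ≥0∞} {n₀ : ℕ}
    (h : ∀ n : ℕ, n₀ ≤ n → T.netMeasure n U ≤ a) : T.limitMeasure U ≤ a :=
  (exists_vague_limit (fun n : ℕ => T.netMeasure n)
    fun _ hK => T.exists_netMeasure_le hK).choose_spec.1 U hU a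
      (Filter.eventually_atTop.2 ⟨n₀, h⟩)

theorem le_limitMeasure {K U : Set X} (hK : IsCompact K) (hU : IsOpen U) (hKU : K ⊆ U)
    {a : ℝ≥0∞} {n₀ : ℕ} (h : ∀ n : ℕ, n₀ ≤ n → a ≤ T.netMeasure n K) : a ≤ T.limitMeasure U :=
  (exists_vague_limit (fun n : ℕ => T.netMeasure n)
    fun _ hK => T.exists_netMeasure_le hK).choose_spec.2 K U hK hU hKU a
      (Filter.eventually_atTop.2 ⟨n₀, h⟩)

theorem mass_le_limitMeasure {k : ℤ} {p : X} (hp : p ∈ T.net k) :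
    T.mass k p ≤ T.limitMeasure (Metric.ball p (3 * netScale k)) := by
  have hs := netScale_pos k
  refine T.le_limitMeasure (isCompact_closedBall p (2 * netScale k)) Metric.isOpen_ball
    (Metric.closedBall_subset_ball (by linarith)) (n₀ := k.toNat) fun n hn => ?_
  obtain ⟨j, hj⟩ : ∃ j : ℕ, k = n - j := ⟨(n - k).toNat, by omega⟩
  subst hj
  refine T.mass_le_netMeasure j n Metric.isClosed_closedBall.measurableSet hp fun y hy => ?_
  rw [Metric.mem_closedBall, ← hy]
  exact T.dist_ancestor_le' j n y

theorem limitMeasure_ball_le (k : ℤ) (x : X) (R : ℝ) :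
    T.limitMeasure (Metric.ball x R) ≤
      T.netMeasure k (Metric.closedBall x (R + 2 * netScale k)) := by
  refine T.limitMeasure_le Metric.isOpen_ball (n₀ := k.toNat) fun n hn => ?_
  obtain ⟨j, hj⟩ : ∃ j : ℕ, k = n - j := ⟨(n - k).toNat, by omega⟩
  subst hj
  exact (measure_mono Metric.ball_subset_closedBall).trans (T.netMeasure_closedBall_le j n x R)

/-! ### The limit measure is doubling -/

theorem exists_netScale_le (r : ℝ) (hr : 0 < r) :
    ∃ k : ℤ, netScale k ≤ r ∧ r < netScale (k - 1) := by
  obtain ⟨n, h1, h2⟩ := exists_mem_Ico_zpow hr (show (1 : ℝ) < 100 by norm_num)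
  refine ⟨-n, by simpa [netScale] using h1, ?_⟩
  rw [netScale]
  rwa [show -(-n - 1) = n + 1 by ring]

/-- Choose `k` with `netScale k ≤ r / 4 < netScale (k - 1)`. The ball of radius `r` contains the mass
of a point `p` of generation `k`, and the ball of radius `2 * r` meets only boundedly many regions
of generation `k - 1`, all with masses comparable to that of the parent of `p`. -/
theorem isDoublingMeasure_limitMeasure : IsDoublingMeasure T.limitMeasure := by
  have heta := T.eta_pos
  refine ⟨T.bound * (T.eta ^ 4)⁻¹, fun x r hr => ?_⟩
  obtain ⟨k, hk1, hk2⟩ := exists_netScale_le (r / 4) (by positivity)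
  have hs := netScale_pos k
  -- a net point at distance less than `netScale k` from `x`
  have hp := T.center_mem k x
  have hxp := T.dist_center k x
  set p := T.center k x
  have hlow : (T.mass k p : ℝ≥0∞) ≤ T.limitMeasure (Metric.closedBall x r) := by
    refine (T.mass_le_limitMeasure hp).trans (measure_mono fun y hy => ?_)
    rw [Metric.mem_ball] at hy
    rw [Metric.mem_closedBall]
    linarith [dist_triangle_right y x p, dist_triangle y p x, dist_comm x p]
  have hup : ∀ ρ ≤ 2 * r, T.limitMeasure (Metric.closedBall x ρ) ≤
      (T.bound * (T.eta ^ 4)⁻¹ : ℝ≥0) * T.mass k p := by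
    intro ρ hρ
    have hfin := T.finite_net_inter (k - 1)
      (Metric.isBounded_closedBall (x := x) (r := 10 * netScale (k - 1)))
    have hpar := T.dist_parent k p
    have hsub := netScale_sub_one k
    calc T.limitMeasure (Metric.closedBall x ρ)
        ≤ T.limitMeasure (Metric.ball x (8 * netScale (k - 1))) :=
          measure_mono (Metric.closedBall_subset_ball (by linarith))
      _ ≤ T.netMeasure (k - 1) (Metric.closedBall x (10 * netScale (k - 1))) := by
          convert T.limitMeasure_ball_le (k - 1) x (8 * netScale (k - 1)) using 3
          ring
      _ ≤ hfin.toFinset.card * ((T.eta ^ 4)⁻¹ * T.mass k p : ℝ≥0) := by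
          refine T.netMeasure_le_card_mul _ Metric.isClosed_closedBall.measurableSet _ (by simp)
            fun y hy => ?_
          rw [Finite.mem_toFinset] at hy
          have hy2 := Metric.mem_closedBall.1 hy.2
          rw [le_inv_mul_iff₀ (pow_pos heta 4)]
          calc T.eta ^ 4 * T.mass (k - 1) y
              = T.eta ^ 2 * (T.eta ^ 2 * T.mass (k - 1) y) := by ring
            _ ≤ T.eta ^ 2 * T.mass (k - 1) (T.parent k p) := by
                gcongr
                refine T.eta_sq_mul_mass_le_mass ?_
                linarith [dist_triangle4 y x p (T.parent k p)]
            _ ≤ T.mass k p := T.eta_sq_mul_mass_parent_le k p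
      _ ≤ T.bound * ((T.eta ^ 4)⁻¹ * T.mass k p : ℝ≥0) := by
          gcongr
          refine T.card_le_bound (k - 1) x _ (fun y hy => ?_) fun y hy => ?_
          · exact ((Finite.mem_toFinset _).1 hy).1
          · refine Metric.closedBall_subset_closedBall ?_ ((Finite.mem_toFinset _).1 hy).2
            linarith
      _ = _ := by
          push_cast
          ring
  have hup1 := hup (2 * r) le_rfl
  refine ⟨(ENNReal.coe_pos.2 (T.mass_pos k p)).trans_le (hlow.trans (measure_mono
    (Metric.closedBall_subset_closedBall (by linarith)))), hup1.trans (by gcongr), ?_⟩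
  exact ENNReal.mul_lt_top ENNReal.coe_lt_top
    ((hup r (by linarith)).trans_lt (ENNReal.mul_lt_top ENNReal.coe_lt_top ENNReal.coe_lt_top))

theorem support_limitMeasure : T.limitMeasure.support = univ := by
  refine eq_univ_of_forall fun x => (Measure.mem_support_iff_forall x).2 fun U hU => ?_
  obtain ⟨r, hr, hrU⟩ := Metric.nhds_basis_closedBall.mem_iff.1 hU
  obtain ⟨C, hC⟩ := T.isDoublingMeasure_limitMeasure
  have := (hC x (r / 2) (by positivity)).1
  rw [mul_div_cancel₀ r two_ne_zero] at this
  exact this.trans_le (measure_mono hrU)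

end NetTree

/-! ### Lipschitz curves -/

section Curves

open Filter Topology

variable {X : Type*} [MetricSpace X]

/-- If the cumulative variation `v` of a continuous curve stays in `[p, q]` in between the
parameters `a` and `b`, then the end points are at distance at most `q - p`. -/
theorem dist_le_of_forall_mem_Ioo {γ : ℝ → X} {v : ℝ → ℝ} {a b p q : ℝ} (hab : a ≤ b) (hpq : p ≤ q)
    (hγ : ContinuousOn γ (Icc a b))
    (hv : ∀ s ∈ Ioo a b, ∀ t ∈ Ioo a b, dist (γ s) (γ t) ≤ |v s - v t|)
    (h : ∀ s ∈ Ioo a b, v s ∈ Icc p q) : dist (γ a) (γ b) ≤ q - p := by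
  rcases hab.eq_or_lt with rfl | hlt
  · simpa using hpq
  have : (𝓝[Ioo a b] a).NeBot := by
    rw [← mem_closure_iff_nhdsWithin_neBot, closure_Ioo hlt.ne]
    exact left_mem_Icc.2 hab
  have : (𝓝[Ioo a b] b).NeBot := by
    rw [← mem_closure_iff_nhdsWithin_neBot, closure_Ioo hlt.ne]
    exact right_mem_Icc.2 hab
  have ha : Tendsto γ (𝓝[Ioo a b] a) (𝓝 (γ a)) :=
    (hγ a (left_mem_Icc.2 hab)).mono Ioo_subset_Icc_self
  have hb : Tendsto γ (𝓝[Ioo a b] b) (𝓝 (γ b)) :=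
    (hγ b (right_mem_Icc.2 hab)).mono Ioo_subset_Icc_self
  refine le_of_tendsto ((ha.comp tendsto_fst).dist (hb.comp tendsto_snd)) ?_
  filter_upwards [prod_mem_prod self_mem_nhdsWithin self_mem_nhdsWithin] with st hst
  refine (hv _ hst.1 _ hst.2).trans ?_
  have h1 := h _ hst.1
  have h2 := h _ hst.2
  rw [abs_le]
  constructor <;> linarith [h1.1, h1.2, h2.1, h2.2]

/-- A curve of finite variation can be reparametrized so that its Lipschitz constant is its total
variation. The new parameter is the proportion of the variation already travelled; it is
inverted by a supremum, so that the continuity of the cumulative variation is not needed. -/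
theorem exists_lipschitzOnWith_of_eVariationOn {γ : ℝ → X} (hγ : ContinuousOn γ (Icc 0 1))
    (hfin : eVariationOn γ (Icc 0 1) ≠ ∞) :
    ∃ f : ℝ → X, f 0 = γ 0 ∧ f 1 = γ 1 ∧
      LipschitzOnWith (eVariationOn γ (Icc 0 1)).toNNReal f (Icc 0 1) := by
  have hloc : LocallyBoundedVariationOn γ (Icc 0 1) :=
    BoundedVariationOn.locallyBoundedVariationOn hfin
  have h0 : (0 : ℝ) ∈ Icc (0 : ℝ) 1 := ⟨le_rfl, zero_le_one⟩
  have h1 : (1 : ℝ) ∈ Icc (0 : ℝ) 1 := ⟨zero_le_one, le_rfl⟩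
  set v := variationOnFromTo γ (Icc 0 1) 0 with hv
  set l : ℝ := (eVariationOn γ (Icc 0 1)).toReal with hl
  have hl0 : 0 ≤ l := ENNReal.toReal_nonneg
  have hmono : MonotoneOn v (Icc 0 1) := variationOnFromTo.monotoneOn hloc h0
  have hv0 : v 0 = 0 := variationOnFromTo.self _ _ _
  have hv1 : v 1 = l := by
    rw [hv, variationOnFromTo.eq_of_le _ _ zero_le_one, inter_self]
  have hle : ∀ s ∈ Icc (0 : ℝ) 1, ∀ t ∈ Icc (0 : ℝ) 1, s ≤ t → dist (γ s) (γ t) ≤ v t - v s := by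
    intro s hs t ht hst
    have := variationOnFromTo.add hloc h0 hs ht
    rw [variationOnFromTo.eq_of_le _ _ hst] at this
    have h2 : dist (γ s) (γ t) ≤ (eVariationOn γ (Icc 0 1 ∩ Icc s t)).toReal := by
      rw [dist_edist]
      exact ENNReal.toReal_mono (hloc s t hs ht)
        (eVariationOn.edist_le _ ⟨hs, le_rfl, hst⟩ ⟨ht, hst, le_rfl⟩)
    simp only [hv]
    linarith
  have habs : ∀ s ∈ Icc (0 : ℝ) 1, ∀ t ∈ Icc (0 : ℝ) 1, dist (γ s) (γ t) ≤ |v s - v t| := by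
    intro s hs t ht
    rcases le_total s t with hst | hst
    · exact (hle s hs t ht hst).trans (abs_sub_comm (v s) (v t) ▸ le_abs_self _)
    · rw [dist_comm]
      exact (hle t ht s hs hst).trans (le_abs_self _)
  let A : ℝ → Set ℝ := fun τ => {t ∈ Icc (0 : ℝ) 1 | v t ≤ τ * l}
  have hA0 : ∀ τ, 0 ≤ τ → 0 ∈ A τ := fun τ hτ => ⟨h0, by rw [hv0]; positivity⟩
  have hAb : ∀ τ, BddAbove (A τ) := fun τ => ⟨1, fun t ht => ht.1.2⟩
  have hσ : ∀ τ, 0 ≤ τ → sSup (A τ) ∈ Icc (0 : ℝ) 1 := fun τ hτ =>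
    ⟨le_csSup (hAb τ) (hA0 τ hτ), csSup_le ⟨0, hA0 τ hτ⟩ fun t ht => ht.1.2⟩
  have hlow : ∀ τ, 0 ≤ τ → ∀ s, 0 ≤ s → s < sSup (A τ) → v s ≤ τ * l := by
    intro τ hτ s hs hlt
    obtain ⟨t, ht, hst⟩ := exists_lt_of_lt_csSup ⟨0, hA0 τ hτ⟩ hlt
    exact (hmono ⟨hs, hst.le.trans ht.1.2⟩ ht.1 hst.le).trans ht.2
  have hup : ∀ τ, 0 ≤ τ → ∀ s ≤ 1, sSup (A τ) < s → τ * l ≤ v s := by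
    intro τ hτ s hs hlt
    by_contra! hcon
    exact absurd (le_csSup (hAb τ) ⟨⟨(hσ τ hτ).1.trans hlt.le, hs⟩, hcon.le⟩) (not_le.2 hlt)
  have hIcc : ∀ a ∈ Icc (0 : ℝ) 1, ∀ b ∈ Icc (0 : ℝ) 1, Icc a b ⊆ Icc 0 1 :=
    fun a ha b hb => Icc_subset_Icc ha.1 hb.2
  refine ⟨fun τ => γ (sSup (A τ)), ?_, ?_, ?_⟩
  · have hσ0 := hσ 0 le_rfl
    have hsub := hIcc 0 h0 _ hσ0
    have := dist_le_of_forall_mem_Ioo (p := 0) (q := 0) hσ0.1 le_rfl (hγ.mono hsub)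
      (fun s hs t ht => habs s (hsub (Ioo_subset_Icc_self hs)) t (hsub (Ioo_subset_Icc_self ht)))
      fun s hs => ⟨?_, ?_⟩
    · exact (dist_le_zero.1 (by simpa using this)).symm
    · exact hv0 ▸ hmono h0 (hsub (Ioo_subset_Icc_self hs)) hs.1.le
    · simpa using hlow 0 le_rfl s hs.1.le hs.2
  · have : sSup (A 1) = 1 :=
      le_antisymm (hσ 1 zero_le_one).2 (le_csSup (hAb 1) ⟨h1, by rw [hv1, one_mul]⟩)
    simp only [this]
  · refine LipschitzOnWith.of_dist_le_mul fun x hx y hy => ?_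
    change _ ≤ l * _
    wlog hxy : x ≤ y generalizing x y
    · rw [dist_comm, dist_comm x]
      exact this y hy x hx (le_of_not_ge hxy)
    have hσx := hσ x hx.1
    have hσy := hσ y hy.1
    have hsub := hIcc _ hσx _ hσy
    have hσxy : sSup (A x) ≤ sSup (A y) := csSup_le_csSup (hAb y) ⟨0, hA0 x hx.1⟩
      fun t ht => ⟨ht.1, ht.2.trans (by gcongr)⟩
    have := dist_le_of_forall_mem_Ioo (p := x * l) (q := y * l) hσxy (by gcongr) (hγ.mono hsub)
      (fun s hs t ht => habs s (hsub (Ioo_subset_Icc_self hs)) t (hsub (Ioo_subset_Icc_self ht)))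
      fun s hs => ⟨hup x hx.1 s (hs.2.le.trans hσy.2) hs.1,
        hlow y hy.1 s (hσx.1.trans hs.1.le) hs.2⟩
    refine this.trans_eq ?_
    rw [Real.dist_eq, abs_sub_comm, abs_of_nonneg (sub_nonneg.2 hxy)]
    ring

/-- Points of a compact set are joined by curves on `[a, b]` with a uniform Lipschitz constant, if
their distance is at most a fixed multiple of `b - a`. -/
theorem IsLocallyQuasiconvex.exists_lipschitzOnWith (h : IsLocallyQuasiconvex X) {E : Set X}
    (hE : IsCompact E) (L : ℝ≥0) :
    ∃ M : ℝ≥0, ∀ x ∈ E, ∀ y ∈ E, ∀ a b : ℝ, a ≤ b → dist x y ≤ L * (b - a) →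
      ∃ f : ℝ → X, f a = x ∧ f b = y ∧ LipschitzOnWith M f (Icc a b) := by
  obtain ⟨C, -, hC⟩ := h E hE
  refine ⟨C * L, fun x hx y hy a b hab hxy => ?_⟩
  by_cases hne : x = y
  · subst hne
    exact ⟨fun _ => x, rfl, rfl, LipschitzWith.const' x |>.lipschitzOnWith⟩
  have hlt : a < b := by
    refine hab.lt_of_ne fun heq => hne (dist_le_zero.1 ?_)
    simpa [heq] using hxy
  obtain ⟨γ, hγ, rfl, rfl, hvar⟩ := hC x hx y hy hne
  have hfin : eVariationOn γ (Icc 0 1) ≠ ∞ :=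
    ne_top_of_le_ne_top (ENNReal.mul_ne_top ENNReal.coe_ne_top (edist_ne_top _ _)) hvar
  obtain ⟨f, hf0, hf1, hf⟩ := exists_lipschitzOnWith_of_eVariationOn hγ hfin
  have hba : 0 < b - a := sub_pos.2 hlt
  refine ⟨fun t => f ((t - a) / (b - a)), by simpa using hf0, by simpa [hba.ne'] using hf1, ?_⟩
  refine LipschitzOnWith.of_dist_le_mul fun s hs t ht => ?_
  have hmem : ∀ s ∈ Icc a b, (s - a) / (b - a) ∈ Icc (0 : ℝ) 1 := fun s hs =>
    ⟨div_nonneg (sub_nonneg.2 hs.1) hba.le, (div_le_one hba).2 (by linarith [hs.2])⟩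
  have hl : ((eVariationOn γ (Icc 0 1)).toNNReal : ℝ) ≤ C * dist (γ 0) (γ 1) := by
    have := ENNReal.toReal_mono (ENNReal.mul_ne_top ENNReal.coe_ne_top (edist_ne_top _ _)) hvar
    rwa [ENNReal.toReal_mul, ← dist_edist] at this
  have hdist : dist ((s - a) / (b - a)) ((t - a) / (b - a)) = dist s t / (b - a) := by
    rw [Real.dist_eq, Real.dist_eq, ← sub_div, abs_div, abs_of_pos hba]
    congr 2
    ring
  calc dist (f ((s - a) / (b - a))) (f ((t - a) / (b - a)))
      ≤ _ * dist ((s - a) / (b - a)) ((t - a) / (b - a)) := hf.dist_le_mul _ (hmem s hs) _ (hmem t ht)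
    _ ≤ (C * (L * (b - a))) * (dist s t / (b - a)) := by
        rw [hdist]
        gcongr
        exact hl.trans (by gcongr)
    _ = _ := by
        push_cast
        field_simp

/-- In a locally quasiconvex space a Lipschitz map on a compact set of parameters extends to a
Lipschitz curve, by filling in the gaps of the set of parameters. -/
theorem IsLocallyQuasiconvex.exists_extension (h : IsLocallyQuasiconvex X) {K : Set ℝ}
    (hK : IsCompact K) (hKne : K.Nonempty) {L : ℝ≥0} {g : ℝ → X} (hg : LipschitzOnWith L g K) :
    ∃ (M : ℝ≥0) (f : ℝ → X), LipschitzOnWith M f (Icc (sInf K) (sSup K)) ∧ EqOn f g K := by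
  obtain ⟨M, hM⟩ := h.exists_lipschitzOnWith (hK.image_of_continuousOn hg.continuousOn) L
  have key : ∀ u v, u ∈ K → v ∈ K → u ≤ v →
      ∃ f : ℝ → X, f u = g u ∧ f v = g v ∧ LipschitzOnWith M f (Icc u v) := fun u v hu hv huv => by
    refine hM _ (mem_image_of_mem g hu) _ (mem_image_of_mem g hv) u v huv ?_
    simpa [Real.dist_eq, abs_sub_comm u, abs_of_nonneg (sub_nonneg.2 huv)] using
      hg.dist_le_mul u hu v hv
  have : Nonempty X := ⟨g 0⟩
  choose! Γ hΓu hΓv hΓ using key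
  -- the last parameter in `K` before `t`, and the first one after `t`
  let prev : ℝ → ℝ := fun t => sSup (K ∩ Iic t)
  let next : ℝ → ℝ := fun t => sInf (K ∩ Ici t)
  have hprev : ∀ t ∈ Icc (sInf K) (sSup K), prev t ∈ K ∩ Iic t := fun t ht =>
    (hK.inter_right isClosed_Iic).sSup_mem ⟨sInf K, hK.sInf_mem hKne, ht.1⟩
  have hnext : ∀ t ∈ Icc (sInf K) (sSup K), next t ∈ K ∩ Ici t := fun t ht =>
    (hK.inter_right isClosed_Ici).sInf_mem ⟨sSup K, hK.sSup_mem hKne, ht.2⟩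
  have hprev_ge : ∀ u t, u ∈ K → u ≤ t → u ≤ prev t := fun u t hu hut =>
    le_csSup (hK.inter_right isClosed_Iic).bddAbove ⟨hu, hut⟩
  have hnext_le : ∀ u t, u ∈ K → t ≤ u → next t ≤ u := fun u t hu hut =>
    csInf_le (hK.inter_right isClosed_Ici).bddBelow ⟨hu, hut⟩
  have hKI : K ⊆ Icc (sInf K) (sSup K) := fun t ht =>
    ⟨csInf_le hK.bddBelow ht, le_csSup hK.bddAbove ht⟩
  refine ⟨max M L, fun t => Γ (prev t) (next t) t,
    LipschitzOnWith.of_dist_le_mul fun s hs t ht => ?_, fun t ht => ?_⟩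
  · wlog hst : s ≤ t generalizing s t
    · rw [dist_comm, dist_comm s]
      exact this t ht s hs (le_of_not_ge hst)
    have hps := hprev s hs
    have hns := hnext s hs
    have hpt := hprev t ht
    have hnt := hnext t ht
    have hs' : s ∈ Icc (prev s) (next s) := ⟨hps.2, hns.2⟩
    have ht' : t ∈ Icc (prev t) (next t) := ⟨hpt.2, hnt.2⟩
    have hΓs := hΓ _ _ hps.1 hns.1 (hs'.1.trans hs'.2)
    have hΓt := hΓ _ _ hpt.1 hnt.1 (ht'.1.trans ht'.2)
    rw [Real.dist_eq, abs_sub_comm, abs_of_nonneg (sub_nonneg.2 hst)]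
    have hMt : (M : ℝ) ≤ (max M L : ℝ≥0) := by exact_mod_cast le_max_left M L
    have hLt : (L : ℝ) ≤ (max M L : ℝ≥0) := by exact_mod_cast le_max_right M L
    rcases le_or_gt (next s) t with hc | hc
    · have hnp : next s ≤ prev t := hprev_ge _ _ hns.1 hc
      have e1 := hΓs.dist_le_mul s hs' (next s) (right_mem_Icc.2 (hs'.1.trans hs'.2))
      have e2 := hg.dist_le_mul _ hns.1 _ hpt.1
      have e3 := hΓt.dist_le_mul (prev t) (left_mem_Icc.2 (ht'.1.trans ht'.2)) t ht'
      rw [hΓv _ _ hps.1 hns.1 (hs'.1.trans hs'.2), Real.dist_eq, abs_sub_comm,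
        abs_of_nonneg (sub_nonneg.2 hns.2)] at e1
      rw [Real.dist_eq, abs_sub_comm, abs_of_nonneg (sub_nonneg.2 hnp)] at e2
      rw [hΓu _ _ hpt.1 hnt.1 (ht'.1.trans ht'.2), Real.dist_eq, abs_sub_comm,
        abs_of_nonneg (sub_nonneg.2 hpt.2)] at e3
      have e4 := dist_triangle4 (Γ (prev s) (next s) s) (g (next s)) (g (prev t))
        (Γ (prev t) (next t) t)
      have e5 := mul_le_mul_of_nonneg_right hMt (sub_nonneg.2 hns.2)
      have e6 := mul_le_mul_of_nonneg_right hLt (sub_nonneg.2 hnp)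
      have e7 := mul_le_mul_of_nonneg_right hMt (sub_nonneg.2 hpt.2)
      linarith
    · -- `s` and `t` lie in the same gap
      have hn : next t = next s :=
        le_antisymm (hnext_le _ _ hns.1 hc.le) (hnext_le _ _ hnt.1 (hst.trans hnt.2))
      have hpl : prev t ≤ s := by
        by_contra! hcon
        exact absurd (hnext_le _ _ hpt.1 hcon.le) (not_le.2 (lt_of_le_of_lt hpt.2 hc))
      have hp : prev t = prev s :=
        le_antisymm (hprev_ge _ _ hpt.1 hpl) (hprev_ge _ _ hps.1 (hps.2.trans hst))
      rw [hn, hp] at ht' ⊢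
      have e1 := hΓs.dist_le_mul s hs' t ht'
      rw [Real.dist_eq, abs_sub_comm, abs_of_nonneg (sub_nonneg.2 hst)] at e1
      exact e1.trans (mul_le_mul_of_nonneg_right hMt (sub_nonneg.2 hst))
  · have e1 : prev t = t := le_antisymm (hprev t (hKI ht)).2 (hprev_ge t t ht le_rfl)
    have e2 : next t = t := le_antisymm (hnext_le t t ht le_rfl) (hnext t (hKI ht)).2
    simp only [e1, e2]
    exact hΓu t t ht ht le_rfl

theorem isRectifiableCurve_image {M : ℝ≥0} {f : ℝ → X} {a b : ℝ} (hab : a ≤ b)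
    (hf : LipschitzOnWith M f (Icc a b)) : IsRectifiableCurve (f '' Icc a b) := by
  let φ : ℝ → ℝ := fun t => a + t * (b - a)
  have hφ : Continuous φ := by fun_prop
  have hmono : Monotone φ := fun s t hst => by
    simp only [φ]
    gcongr
  have h0 : φ 0 = a := by simp [φ]
  have h1 : φ 1 = b := by simp [φ]
  have himg : φ '' Icc 0 1 = Icc a b := by
    refine Subset.antisymm ?_ ?_
    · rintro _ ⟨t, ht, rfl⟩
      exact ⟨h0 ▸ hmono ht.1, h1 ▸ hmono ht.2⟩
    · have := intermediate_value_Icc (zero_le_one' ℝ) hφ.continuousOn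
      rwa [h0, h1] at this
  have hmaps : MapsTo φ (Icc 0 1) (Icc a b) := himg ▸ mapsTo_image φ _
  refine ⟨f ∘ φ, hf.continuousOn.comp hφ.continuousOn hmaps, ?_, by rw [image_comp, himg]⟩
  refine (hf.comp_eVariationOn_le hmaps).trans_lt (ENNReal.mul_lt_top ENNReal.coe_lt_top ?_)
  have := (hmono.monotoneOn (Icc 0 1)).eVariationOn_eq (left_mem_Icc.2 (zero_le_one' ℝ))
    (right_mem_Icc.2 (zero_le_one' ℝ))
  rw [inter_self] at this
  exact this ▸ ENNReal.ofReal_lt_top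

/-- A set that admits a bounded expanding map `h` to the real line is contained in a rectifiable
curve: the inverse of `h` is Lipschitz, and extends to an interval. -/
theorem IsLocallyQuasiconvex.exists_isRectifiableCurve_superset [ProperSpace X] [Nonempty X]
    (hX : IsLocallyQuasiconvex X) {A : Set X} {h : X → ℝ} {L : ℝ≥0} {B : ℝ}
    (hL : ∀ x ∈ A, ∀ y ∈ A, dist x y ≤ L * |h x - h y|) (hB : ∀ x ∈ A, |h x| ≤ B) :
    ∃ Γ, IsRectifiableCurve Γ ∧ A ⊆ Γ := by
  rcases A.eq_empty_or_nonempty with rfl | ⟨x₀, hx₀⟩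
  · obtain ⟨o⟩ := ‹Nonempty X›
    exact ⟨_, isRectifiableCurve_image (M := 0) (f := fun _ => o) zero_le_one
      (LipschitzWith.const o).lipschitzOnWith, empty_subset _⟩
  -- the closure of the graph of the inverse of `h` is again the graph of a Lipschitz map
  let G : Set (ℝ × X) := (fun x => (h x, x)) '' A
  have hGb : Bornology.IsBounded G := by
    refine ((Metric.isBounded_closedBall (x := (0 : ℝ)) (r := B)).prod
      (Metric.isBounded_closedBall (x := x₀) (r := L * (B + B)))).subset ?_
    rintro _ ⟨x, hx, rfl⟩
    refine ⟨by simpa using hB x hx, Metric.mem_closedBall.2 ((hL x hx x₀ hx₀).trans ?_)⟩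
    gcongr
    exact (abs_sub _ _).trans (add_le_add (hB x hx) (hB x₀ hx₀))
  have hGc : IsCompact (closure G) := hGb.isCompact_closure
  have hGL : ∀ p ∈ closure G, ∀ q ∈ closure G, dist p.2 q.2 ≤ L * |p.1 - q.1| := by
    have hcl : IsClosed {pq : (ℝ × X) × ℝ × X | dist pq.1.2 pq.2.2 ≤ L * |pq.1.1 - pq.2.1|} :=
      isClosed_le (by fun_prop) (by fun_prop)
    have hsub : G ×ˢ G ⊆ {pq : (ℝ × X) × ℝ × X | dist pq.1.2 pq.2.2 ≤ L * |pq.1.1 - pq.2.1|} := by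
      rintro ⟨_, _⟩ ⟨⟨x, hx, rfl⟩, ⟨y, hy, rfl⟩⟩
      exact hL x hx y hy
    intro p hp q hq
    have := closure_minimal hsub hcl
    rw [closure_prod_eq] at this
    exact this (mk_mem_prod hp hq)
  have key : ∀ t ∈ Prod.fst '' closure G, ∃ x, (t, x) ∈ closure G := by
    rintro _ ⟨⟨t, x⟩, hx, rfl⟩
    exact ⟨x, hx⟩
  choose! g hg using key
  have hgA : ∀ x ∈ A, h x ∈ Prod.fst '' closure G ∧ g (h x) = x := by
    intro x hx
    have hxG : (h x, x) ∈ closure G := subset_closure ⟨x, hx, rfl⟩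
    have hmem : h x ∈ Prod.fst '' closure G := ⟨_, hxG, rfl⟩
    refine ⟨hmem, dist_le_zero.1 ?_⟩
    simpa using hGL _ (hg _ hmem) _ hxG
  have hgL : LipschitzOnWith L g (Prod.fst '' closure G) :=
    LipschitzOnWith.of_dist_le_mul fun s hs t ht => hGL _ (hg s hs) _ (hg t ht)
  have hK := hGc.image continuous_fst
  obtain ⟨M, f, hf, hfg⟩ := hX.exists_extension hK ⟨_, (hgA x₀ hx₀).1⟩ hgL
  have hle : ∀ t ∈ Prod.fst '' closure G, t ∈ Icc (sInf (Prod.fst '' closure G))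
    (sSup (Prod.fst '' closure G)) := fun t ht =>
      ⟨csInf_le hK.bddBelow ht, le_csSup hK.bddAbove ht⟩
  have h0 := hle _ (hgA x₀ hx₀).1
  refine ⟨_, isRectifiableCurve_image (h0.1.trans h0.2) hf,
    fun x hx => ⟨h x, hle _ (hgA x hx).1, ?_⟩⟩
  rw [hfg (hgA x hx).1, (hgA x hx).2]

/-! ### Expanding maps from lexicographic orders -/

/-- Let each point of `A` be given a sequence of labels, such that each label determines the
preceding one, and such that points with the same label at index `n` are at distance at most
`L * r (n + 1)`. If the numbers of labels at index `n` are at most `m n` and `∑ m n * r n < ∞`,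
then `A` has a bounded expanding map to the real line. It is obtained by putting a point of
mass `r n` for each label at index `n`, in the lexicographic order. -/
theorem exists_expanding {β : Type*} {A : Set X} (p : ℕ → X → β) {r m : ℕ → ℝ} {L : ℝ}
    (hr0 : ∀ n, 0 ≤ r n) (hr : Tendsto r atTop (𝓝 0)) (hL0 : 0 ≤ L)
    (hstart : ∀ x ∈ A, ∀ y ∈ A, p 0 x = p 0 y)
    (hp : ∀ n, ∀ x ∈ A, ∀ y ∈ A, p (n + 1) x = p (n + 1) y → p n x = p n y)
    (hdist : ∀ n, ∀ x ∈ A, ∀ y ∈ A, p n x = p n y → dist x y ≤ L * r (n + 1))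
    (hfin : ∀ n, (p n '' A).Finite) (hm : ∀ n, ((p n '' A).ncard : ℝ) ≤ m n)
    (hsum : Summable fun n => r n * m n) :
    ∃ (h : X → ℝ) (B : ℝ), (∀ x ∈ A, ∀ y ∈ A, dist x y ≤ L * |h x - h y|) ∧
      ∀ x ∈ A, |h x| ≤ B := by
  classical
  let _ : LinearOrder β := linearOrderOfSTO WellOrderingRel
  have hp' : ∀ n, ∀ i ≤ n, ∀ x ∈ A, ∀ y ∈ A, p n x = p n y → p i x = p i y := by
    intro n i hi x hx y hy
    induction n, hi using Nat.le_induction with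
    | base => exact id
    | succ n _ ih => exact fun h => ih (hp n x hx y hy h)
  -- the labels at index `n` that come before `x`
  let S : ℕ → X → Set β := fun n x =>
    {s | ∃ z ∈ A, p n z = s ∧ ∃ i ≤ n, (∀ j < i, p j z = p j x) ∧ p i z < p i x}
  have hSsub : ∀ n x, S n x ⊆ p n '' A := fun n x s ⟨z, hz, hzs, _⟩ => ⟨z, hz, hzs⟩
  have hSfin : ∀ n x, (S n x).Finite := fun n x => (hfin n).subset (hSsub n x)
  have hbd : ∀ x n, r n * (S n x).ncard ≤ r n * m n := fun x n => by
    refine mul_le_mul_of_nonneg_left (le_trans ?_ (hm n)) (hr0 n)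
    exact_mod_cast ncard_le_ncard (hSsub n x) (hfin n)
  have hnn : ∀ x n, 0 ≤ r n * ((S n x).ncard : ℝ) :=
    fun x n => mul_nonneg (hr0 n) (Nat.cast_nonneg _)
  have hsumS : ∀ x, Summable fun n => r n * ((S n x).ncard : ℝ) := fun x =>
    Summable.of_nonneg_of_le (hnn x) (hbd x) hsum
  refine ⟨fun x => ∑' n, r n * ((S n x).ncard : ℝ), ∑' n, r n * m n, ?_, fun x _ => ?_⟩
  · -- if `x` comes before `y` and `n` is the first index at which they differ
    have hlt : ∀ x ∈ A, ∀ y ∈ A, ∀ n, (∀ j < n, p j x = p j y) → p n x < p n y →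
        r n ≤ (∑' n, r n * ((S n y).ncard : ℝ)) - ∑' n, r n * ((S n x).ncard : ℝ) := by
      intro x hx y hy n hag hlt
      have hmono : ∀ i, S i x ⊆ S i y := by
        rintro i s ⟨z, hz, hzs, j, hj, hzj, hzlt⟩
        refine ⟨z, hz, hzs, ?_⟩
        rcases lt_trichotomy j n with hjn | rfl | hjn
        · exact ⟨j, hj, fun l hl => (hzj l hl).trans (hag l (hl.trans hjn)), hag j hjn ▸ hzlt⟩
        · exact ⟨j, hj, fun l hl => (hzj l hl).trans (hag l hl), hzlt.trans hlt⟩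
        · exact ⟨n, hjn.le.trans hj, fun l hl => (hzj l (hl.trans hjn)).trans (hag l hl),
            (hzj n hjn) ▸ hlt⟩
      have hin : p n x ∈ S n y := ⟨x, hx, rfl, n, le_rfl, hag, hlt⟩
      have hout : p n x ∉ S n x := by
        rintro ⟨z, hz, hzx, i, hi, -, hzi⟩
        exact hzi.ne (hp' n i hi z hz x hx hzx)
      have hcard : (S n x).ncard + 1 ≤ (S n y).ncard := by
        rw [← ncard_insert_of_notMem hout (hSfin n x)]
        exact ncard_le_ncard (insert_subset hin (hmono n)) (hSfin n y)
      rw [← (hsumS y).tsum_sub (hsumS x)]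
      refine le_trans ?_ (((hsumS y).sub (hsumS x)).le_tsum n fun i _ => ?_)
      · rw [← mul_sub]
        refine le_mul_of_one_le_right (hr0 n) ?_
        have : ((S n x).ncard : ℝ) + 1 ≤ (S n y).ncard := by exact_mod_cast hcard
        linarith
      · rw [← mul_sub]
        refine mul_nonneg (hr0 i) (sub_nonneg.2 ?_)
        exact_mod_cast ncard_le_ncard (hmono i) (hSfin i y)
    intro x hx y hy
    by_cases hall : ∀ n, p n x = p n y
    · have hlim : Tendsto (fun n => L * r (n + 1)) atTop (𝓝 0) := by
        simpa using ((tendsto_add_atTop_iff_nat 1).2 hr).const_mul L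
      have : dist x y ≤ 0 := ge_of_tendsto' hlim fun n => hdist n x hx y hy (hall n)
      exact this.trans (by positivity)
    · push Not at hall
      have hag : ∀ j < Nat.find hall, p j x = p j y := fun j hj => not_not.1 (Nat.find_min hall hj)
      have hne := Nat.find_spec hall
      set n := Nat.find hall
      have hn : n ≠ 0 := fun h0 => hne (h0 ▸ hstart x hx y hy)
      obtain ⟨k, hk⟩ := Nat.exists_eq_succ_of_ne_zero hn
      have hd := hdist k x hx y hy (hag k (by omega))
      rw [← Nat.succ_eq_add_one, ← hk] at hd
      refine hd.trans (mul_le_mul_of_nonneg_left ?_ hL0)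
      rcases lt_or_gt_of_ne hne with hlt' | hlt'
      · rw [abs_sub_comm]
        exact (hlt x hx y hy n hag hlt').trans (le_abs_self _)
      · exact (hlt y hy x hx n (fun j hj => (hag j hj).symm) hlt').trans (le_abs_self _)
  · rw [abs_of_nonneg (tsum_nonneg (hnn x))]
    exact (hsumS x).tsum_le_tsum (hbd x) hsum

end Curves

/-! ### The limit measure is concentrated on thin subtrees -/

namespace NetTree

variable {X : Type*} [MetricSpace X] (T : NetTree X)

theorem ancestor_add (a b : ℕ) (k : ℤ) (y : X) :
    T.ancestor (a + b) k y = T.ancestor b (k - a) (T.ancestor a k y) := by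
  induction a generalizing k y with
  | zero => simp [ancestor]
  | succ a ih =>
    rw [Nat.succ_add, ancestor, ih, ancestor]
    congr 1
    push_cast
    ring

theorem ancestor_natCast_succ (n m : ℕ) (y : X) :
    T.ancestor (m + 1) (n + 1 : ℕ) y = T.ancestor m n (T.parent (n + 1 : ℕ) y) := by
  rw [ancestor]
  congr 1
  push_cast
  ring

/-- The size of a point of generation `n`, relative to its ancestor in generation `0`. -/
noncomputable def size (n : ℕ) (y : X) : ℝ≥0 := T.ancestorProd T.sizeRatio n n y

/-- The points that are limits of a branch of the tree which starts at `v` in generation `0` and on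
which the sizes do not fall below `c / 2 ^ n`. -/
def branchSet (c : ℝ≥0) (v : X) : Set X :=
  {x | ∃ w : ℕ → X, w 0 = v ∧ ∀ n : ℕ, w n ∈ T.net n ∧ w n = T.parent (n + 1 : ℕ) (w (n + 1)) ∧
    c / 2 ^ n ≤ T.size n (w n) ∧ dist x (w n) ≤ 2 * netScale n}

/-- A point of generation `n` is good if neither its size nor that of one of its ancestors falls
below the threshold `c / 2 ^ i`. -/
def IsGood (c : ℝ≥0) (n : ℕ) (y : X) : Prop :=
  ∀ i ≤ n, c / 2 ^ i ≤ T.size i (T.ancestor (n - i) n y)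

theorem IsGood.parent {c : ℝ≥0} {n : ℕ} {y : X} (h : T.IsGood c (n + 1) y) :
    T.IsGood c n (T.parent (n + 1 : ℕ) y) := by
  intro i hi
  have := h i (by omega)
  rwa [Nat.succ_sub hi, ancestor_natCast_succ] at this

/-- The points within `R` of the root that are far from all good points of generation `n`. -/
def awayFromGood (c : ℝ≥0) (R : ℝ) (n : ℕ) : Set X :=
  {x ∈ Metric.ball T.root R | ∀ y ∈ T.net n, T.IsGood c n y → 2 * netScale n < dist x y}

theorem monotone_awayFromGood (c : ℝ≥0) (R : ℝ) : Monotone (T.awayFromGood c R) := by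
  refine monotone_nat_of_le_succ fun n x hx => ⟨hx.1, fun y _ hg => ?_⟩
  by_contra! hcon
  have h1 : T.parent (n + 1 : ℕ) y ∈ T.net n := by
    simpa using T.parent_mem (n + 1 : ℕ) y
  have h2 := hx.2 _ h1 hg.parent
  have h3 := T.dist_parent (n + 1 : ℕ) y
  have h4 := netScale_sub_one (n + 1 : ℕ)
  rw [show ((n + 1 : ℕ) : ℤ) - 1 = n by push_cast; ring] at h3 h4
  linarith [dist_triangle x y (T.parent (n + 1 : ℕ) y), netScale_pos (n + 1 : ℕ)]

section

variable [ProperSpace X]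

/-- Under a given point of generation `0` there are at most `3 ^ n / c` points of generation `n` with
size at least `c / 2 ^ n`, as the sizes of all points have sum at most `(3 / 2) ^ n`. -/
theorem card_mul_le_of_size_ge {c : ℝ≥0} {n : ℕ} {v : X} (F : Finset X)
    (hF : ∀ y ∈ F, y ∈ T.net n ∧ T.ancestor n n y = v ∧ c / 2 ^ n ≤ T.size n y) :
    F.card * c ≤ 3 ^ n := by
  have h1 := T.tsum_size_ancestor_le n n (({v} : Set X).indicator 1)
  have h2 : ∑' x, (T.net ((n : ℤ) - n)).indicator (({v} : Set X).indicator (1 : X → ℝ≥0∞)) x ≤ 1 := by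
    rw [tsum_eq_single v fun x hx => by simp [indicator, hx]]
    exact (indicator_le_self _ _ _).trans (by simp)
  have h3 : (F.card : ℝ≥0∞) * (c / 2 ^ n : ℝ≥0) ≤ (3 / 2) ^ n := by
    calc (F.card : ℝ≥0∞) * (c / 2 ^ n : ℝ≥0)
        ≤ ∑ y ∈ F, (T.net n).indicator (fun y => T.ancestorProd T.sizeRatio n n y *
            ({v} : Set X).indicator (1 : X → ℝ≥0∞) (T.ancestor n n y)) y := by
          rw [← nsmul_eq_mul]
          refine Finset.card_nsmul_le_sum _ _ _ fun y hy => ?_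
          obtain ⟨hy1, hy2, hy3⟩ := hF y hy
          rw [indicator_of_mem hy1, hy2, indicator_of_mem (mem_singleton v), Pi.one_apply, mul_one]
          exact ENNReal.coe_le_coe.2 hy3
      _ ≤ _ := ENNReal.sum_le_tsum F
      _ ≤ (3 / 2) ^ n * 1 := h1.trans (by gcongr)
      _ = _ := mul_one _
  have h4 : (F.card : ℝ≥0) * (c / 2 ^ n) ≤ (3 / 2) ^ n := by
    rw [← ENNReal.coe_le_coe]
    push_cast [ENNReal.coe_div]
    simpa using h3
  rw [div_pow, mul_div_assoc'] at h4
  exact (div_le_div_iff_of_pos_right (by positivity)).1 h4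

theorem exists_isRectifiableCurve_branchSet_subset [Nonempty X] (hX : IsLocallyQuasiconvex X)
    {c : ℝ≥0} (hc : 0 < c) (v : X) : ∃ Γ, IsRectifiableCurve Γ ∧ T.branchSet c v ⊆ Γ := by
  have key : ∀ x ∈ T.branchSet c v, ∃ w : ℕ → X, w 0 = v ∧ ∀ n : ℕ, w n ∈ T.net n ∧
    w n = T.parent (n + 1 : ℕ) (w (n + 1)) ∧ c / 2 ^ n ≤ T.size n (w n) ∧
      dist x (w n) ≤ 2 * netScale n := fun x hx => hx
  choose! w hw0 hw using key
  have hanc : ∀ n : ℕ, ∀ x ∈ T.branchSet c v, T.ancestor n n (w x n) = v := by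
    intro n x hx
    induction n with
    | zero => exact hw0 x hx
    | succ n ih => rw [ancestor_natCast_succ, ← (hw x hx n).2.1, ih]
  have hfin : ∀ n : ℕ, ((fun x => w x n) '' T.branchSet c v).Finite := by
    intro n
    refine (T.finite_net_inter n
      (Metric.isBounded_closedBall (x := v) (r := 2 * netScale 0))).subset ?_
    rintro _ ⟨x, hx, rfl⟩
    refine ⟨(hw x hx n).1, ?_⟩
    have := T.dist_ancestor_le' n n (w x n)
    rwa [hanc n x hx, sub_self] at this
  have hcard : ∀ n : ℕ, (((fun x => w x n) '' T.branchSet c v).ncard : ℝ) ≤ 3 ^ n / c := by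
    intro n
    rw [le_div_iff₀ (by exact_mod_cast hc), ncard_eq_toFinset_card _ (hfin n)]
    have := T.card_mul_le_of_size_ge (c := c) (n := n) (v := v) (hfin n).toFinset fun y hy => by
      obtain ⟨x, hx, rfl⟩ := (Finite.mem_toFinset _).1 hy
      exact ⟨(hw x hx n).1, hanc n x hx, (hw x hx n).2.2.1⟩
    exact_mod_cast this
  have hscale : ∀ n : ℕ, netScale (n + 1 : ℕ) = netScale n / 100 := fun n => by
    rw [netScale_natCast, netScale_natCast, pow_succ]
    ring
  have hr : Filter.Tendsto (fun n : ℕ => netScale n) Filter.atTop (nhds 0) := by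
    simp only [netScale_natCast]
    exact tendsto_pow_atTop_nhds_zero_of_lt_one (by norm_num) (by norm_num)
  have hsum : Summable fun n : ℕ => netScale n * ((3 : ℝ) ^ n / c) := by
    refine ((summable_geometric_of_lt_one (r := 3 / 100) (by norm_num) (by norm_num)).mul_right
      (1 / (c : ℝ))).congr fun n => ?_
    rw [netScale_natCast, div_pow, div_pow]
    ring
  obtain ⟨h, B, hL, hB⟩ := exists_expanding (A := T.branchSet c v) (fun n x => w x n)
    (r := fun n : ℕ => netScale n) (m := fun n => 3 ^ n / c) (L := (400 : ℝ≥0))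
    (fun n => (netScale_pos n).le) hr (by positivity)
    (fun x hx y hy => (hw0 x hx).trans (hw0 y hy).symm)
    (fun n x hx y hy hxy => by
      rw [(hw x hx n).2.1, (hw y hy n).2.1, hxy])
    (fun n x hx y hy hxy => by
      have h1 := (hw x hx n).2.2.2
      have h2 := (hw y hy n).2.2.2
      rw [← hxy] at h2
      rw [hscale]
      push_cast
      linarith [dist_triangle_right x y (w x n)])
    hfin hcard hsum
  exact hX.exists_isRectifiableCurve_superset hL hB

open Classical in
/-- The points of small size carry little mass: the mass is at most the square of the size, and the
sum of the sizes grows at most like `(3 / 2) ^ i`. -/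
theorem tsum_mass_small_size_le (c : ℝ≥0) (i : ℕ) (g : X → ℝ≥0∞) :
    ∑' z, (T.net i).indicator (fun z => T.mass i z *
        (if T.size i z < c / 2 ^ i then g (T.ancestor i i z) else 0)) z ≤
      c * (3 / 4) ^ i * ∑' v, (T.net 0).indicator (fun v => T.mass 0 v * g v) v := by
  have h1 := T.tsum_size_ancestor_le i i (fun v => T.mass 0 v * g v)
  rw [sub_self] at h1
  have hconst : (c / 2 ^ i : ℝ≥0) * (3 / 2 : ℝ≥0∞) ^ i = c * (3 / 4) ^ i := by
    have h2 : (c / 2 ^ i : ℝ≥0) * (3 / 2 : ℝ≥0) ^ i = c * (3 / 4) ^ i := by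
      rw [div_mul_eq_mul_div, mul_div_assoc, ← div_pow, div_div]
      norm_num
    have h3 := congrArg ((↑) : ℝ≥0 → ℝ≥0∞) h2
    rw [ENNReal.coe_mul, ENNReal.coe_mul, ENNReal.coe_pow, ENNReal.coe_pow,
      ENNReal.coe_div (r := 2) (by norm_num), ENNReal.coe_div (r := 4) (by norm_num)] at h3
    exact h3
  calc _ ≤ ∑' z, (c / 2 ^ i : ℝ≥0) * (T.net i).indicator (fun z =>
          T.ancestorProd T.sizeRatio i i z *
            (T.mass 0 (T.ancestor i i z) * g (T.ancestor i i z))) z := by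
        refine ENNReal.tsum_le_tsum fun z => ?_
        by_cases hz : z ∈ T.net i
        · rw [indicator_of_mem hz, indicator_of_mem hz]
          split_ifs with hs
          · rw [← mul_assoc, ← mul_assoc, ← ENNReal.coe_mul, ← ENNReal.coe_mul]
            gcongr
            have := T.mass_eq_ancestorProd i i z
            rw [sub_self] at this
            rw [this]
            gcongr
            refine (T.ancestorProd_massRatio_le i i z).trans ?_
            rw [sq]
            gcongr
            exact hs.le
          · simp
        · simp [hz]
    _ ≤ (c / 2 ^ i : ℝ≥0) * ((3 / 2) ^ i *
          ∑' v, (T.net 0).indicator (fun v => T.mass 0 v * g v) v) := by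
        rw [ENNReal.tsum_mul_left]
        gcongr
    _ = _ := by rw [← mul_assoc, hconst]

open Classical in
/-- The constant is `∑ (3 / 4) ^ i = 4`, as each point that is not good has an ancestor of small size
in some generation `i`. -/
theorem tsum_mass_not_isGood_le (c : ℝ≥0) (n : ℕ) (g : X → ℝ≥0∞) :
    ∑' z, (T.net n).indicator (fun z => T.mass n z *
        (if T.IsGood c n z then 0 else g (T.ancestor n n z))) z ≤
      4 * c * ∑' v, (T.net 0).indicator (fun v => T.mass 0 v * g v) v := by
  calc _ ≤ ∑' z, ∑ i ∈ Finset.range (n + 1), (T.net n).indicator (fun z => T.mass n z *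
          (if T.size i (T.ancestor (n - i) n z) < c / 2 ^ i then
            g (T.ancestor i i (T.ancestor (n - i) n z)) else 0)) z := by
        refine ENNReal.tsum_le_tsum fun z => ?_
        by_cases hz : z ∈ T.net n
        · simp only [indicator_of_mem hz]
          by_cases hg : T.IsGood c n z
          · simp [hg]
          · unfold IsGood at hg
            push Not at hg
            obtain ⟨i, hi, hs⟩ := hg
            refine le_trans ?_ (Finset.single_le_sum (fun _ _ => zero_le)
              (Finset.mem_range.2 (Nat.lt_succ_of_le hi)))
            rw [if_pos hs]
            gcongr
            split_ifs
            · exact zero_le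
            · have := T.ancestor_add (n - i) i n z
              rw [Nat.sub_add_cancel hi, show (n : ℤ) - (n - i : ℕ) = i by omega] at this
              rw [this]
        · simp [hz]
    _ = ∑ i ∈ Finset.range (n + 1), ∑' z, (T.net i).indicator (fun z => T.mass i z *
          (if T.size i z < c / 2 ^ i then g (T.ancestor i i z) else 0)) z := by
        rw [Summable.tsum_finsetSum fun _ _ => ENNReal.summable]
        refine Finset.sum_congr rfl fun i hi => ?_
        have hi' : i ≤ n := Nat.lt_succ_iff.1 (Finset.mem_range.1 hi)
        have := T.tsum_mass_ancestor (n - i) n fun z =>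
          if T.size i z < c / 2 ^ i then g (T.ancestor i i z) else 0
        rwa [show (n : ℤ) - (n - i : ℕ) = i by omega] at this
    _ ≤ ∑ i ∈ Finset.range (n + 1), c * (3 / 4) ^ i *
          ∑' v, (T.net 0).indicator (fun v => T.mass 0 v * g v) v :=
        Finset.sum_le_sum fun i _ => T.tsum_mass_small_size_le c i g
    _ ≤ _ := by
        rw [← Finset.sum_mul, ← Finset.mul_sum, mul_comm 4 (c : ℝ≥0∞)]
        gcongr
        refine (ENNReal.sum_le_tsum _).trans_eq ?_
        rw [ENNReal.tsum_geometric]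
        have : (1 : ℝ≥0∞) - 3 / 4 = 4⁻¹ := by
          refine ENNReal.sub_eq_of_eq_add (ENNReal.div_ne_top (by simp) (by simp)) ?_
          rw [← one_div, ENNReal.div_add_div_same, show (1 : ℝ≥0∞) + 3 = 4 by norm_num,
            ENNReal.div_self (by simp) (by simp)]
        rw [this, inv_inv]

theorem isOpen_awayFromGood (c : ℝ≥0) (R : ℝ) (n : ℕ) : IsOpen (T.awayFromGood c R n) := by
  let F : Set X := T.net n ∩ Metric.closedBall T.root (R + 2 * netScale n) ∩ {y | T.IsGood c n y}
  have hF : F.Finite := (T.finite_net_inter n Metric.isBounded_closedBall).subset inter_subset_left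
  have : T.awayFromGood c R n =
      Metric.ball T.root R ∩ (⋃ y ∈ F, Metric.closedBall y (2 * netScale n))ᶜ := by
    ext x
    simp only [awayFromGood, mem_ofPred_eq, mem_inter_iff, mem_compl_iff, mem_iUnion,
      Metric.mem_closedBall, not_exists, not_le, F]
    refine and_congr_right fun hx => ⟨fun h y hy => h y hy.1.1 hy.2, fun h y hy hg => ?_⟩
    by_contra! hcon
    refine absurd (h y ⟨⟨hy, ?_⟩, hg⟩) (not_lt.2 hcon)
    rw [Metric.mem_ball] at hx
    linarith [dist_triangle_left y T.root x]
  rw [this]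
  exact Metric.isOpen_ball.inter
    (hF.isClosed_biUnion fun _ _ => Metric.isClosed_closedBall).isOpen_compl

/-- A point which is close to good points of all generations is the limit of a branch of good
points. This is König's lemma; the branch is selected by an ultrafilter. -/
theorem exists_mem_branchSet {c : ℝ≥0} {x : X}
    (h : ∀ n : ℕ, ∃ y ∈ T.net n, T.IsGood c n y ∧ dist x y ≤ 2 * netScale n) :
    ∃ v ∈ T.net 0, x ∈ T.branchSet c v := by
  choose z hz hgood hdist using h
  let a : ℕ → ℕ → X := fun n m => T.ancestor (m - n) m (z m)
  have hcast : ∀ {n m : ℕ}, n ≤ m → (m : ℤ) - (m - n : ℕ) = n := fun h => by omega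
  have ha : ∀ n m : ℕ, n ≤ m → a n m ∈ T.net n ∩ Metric.closedBall x (2 * netScale n) := by
    intro n m hnm
    have h1 := T.ancestor_mem (n := m - n) (hz m)
    have h2 := T.dist_ancestor_le (m - n) m (z m)
    rw [hcast hnm] at h1 h2
    refine ⟨h1, Metric.mem_closedBall'.2 ?_⟩
    linarith [dist_triangle x (z m) (a n m), hdist m]
  have hge : ∀ n : ℕ, ∀ᶠ m in (Filter.hyperfilter ℕ : Filter ℕ), n ≤ m := fun n =>
    Nat.hyperfilter_le_atTop (Filter.eventually_ge_atTop n)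
  have hw : ∀ n : ℕ, ∃ w ∈ T.net n ∩ Metric.closedBall x (2 * netScale n),
      ∀ᶠ m in (Filter.hyperfilter ℕ : Filter ℕ), a n m = w := fun n => by
    rw [← Ultrafilter.eventually_exists_mem_iff
      (T.finite_net_inter n Metric.isBounded_closedBall)]
    exact (hge n).mono fun m hm => ⟨_, ha n m hm, rfl⟩
  choose w hw1 hw2 using hw
  refine ⟨w 0, by simpa using (hw1 0).1, w, rfl, fun n => ⟨(hw1 n).1, ?_, ?_, ?_⟩⟩
  · obtain ⟨m, ⟨h1, h2⟩, hm⟩ := (((hw2 n).and (hw2 (n + 1))).and (hge (n + 1))).exists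
    rw [← h1, ← h2]
    simp only [a]
    rw [show m - n = m - (n + 1) + 1 by omega, ancestor_succ', hcast hm]
  · obtain ⟨m, h1, hm⟩ := ((hw2 n).and (hge n)).exists
    rw [← h1]
    exact hgood m n hm
  · exact Metric.mem_closedBall'.1 (hw1 n).2

theorem countable_net (k : ℤ) : (T.net k).Countable := by
  have : T.net k = ⋃ R : ℕ, T.net k ∩ Metric.closedBall T.root R := by
    rw [← inter_iUnion, Metric.iUnion_closedBall_nat, inter_univ]
  rw [this]
  exact countable_iUnion fun R => (T.finite_net_inter k Metric.isBounded_closedBall).countable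

end

section

variable [ProperSpace X] [MeasurableSpace X] [BorelSpace X]

theorem netMeasure_awayFromGood_le (c : ℝ≥0) (R : ℝ) (n j : ℕ) :
    T.netMeasure (n + j : ℕ) (T.awayFromGood c R n) ≤
      4 * c * T.netMeasure 0 (Metric.closedBall T.root (R + 4 * netScale 0)) := by
  classical
  rw [T.netMeasure_apply _ (T.isOpen_awayFromGood c R n).measurableSet,
    T.netMeasure_apply 0 Metric.isClosed_closedBall.measurableSet]
  refine le_trans ?_ (T.tsum_mass_not_isGood_le c n _)
  have h1 := T.tsum_mass_ancestor j (n + j : ℕ) fun z => if T.IsGood c n z then 0 else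
    (Metric.closedBall T.root (R + 4 * netScale 0)).indicator (1 : X → ℝ≥0∞) (T.ancestor n n z)
  rw [show ((n + j : ℕ) : ℤ) - j = n by omega] at h1
  rw [← h1]
  refine ENNReal.tsum_le_tsum fun y => indicator_le_indicator' fun hy => ?_
  gcongr
  by_cases hyU : y ∈ T.awayFromGood c R n
  · have hmem := T.ancestor_mem (n := j) hy
    have hd1 := T.dist_ancestor_le' j (n + j : ℕ) y
    rw [show ((n + j : ℕ) : ℤ) - j = n by omega] at hmem hd1
    have hng : ¬ T.IsGood c n (T.ancestor j (n + j : ℕ) y) := fun hg =>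
      absurd (hyU.2 _ hmem hg) (not_lt.2 hd1)
    have hd2 := T.dist_ancestor_le' n n (T.ancestor j (n + j : ℕ) y)
    rw [sub_self] at hd2
    have hs : netScale n ≤ netScale 0 := by
      rw [netScale_natCast, netScale]
      simpa using pow_le_one₀ (n := n) (show (0 : ℝ) ≤ 1 / 100 by norm_num) (by norm_num)
    have hball : T.ancestor n n (T.ancestor j (n + j : ℕ) y) ∈
        Metric.closedBall T.root (R + 4 * netScale 0) := by
      rw [Metric.mem_closedBall']
      have := Metric.mem_ball'.1 hyU.1
      linarith [dist_triangle4 T.root y (T.ancestor j (n + j : ℕ) y)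
        (T.ancestor n n (T.ancestor j (n + j : ℕ) y))]
    rw [if_neg hng, indicator_of_mem hball, indicator_of_mem hyU, Pi.one_apply, Pi.one_apply]
  · simp [hyU]

/-- A point that is not the limit of a branch of good points is away from the good points of some
generation; these form an increasing sequence of open sets with small mass. -/
theorem limitMeasure_ball_diff_branchSet_le (c : ℝ≥0) (R : ℝ) :
    T.limitMeasure (Metric.ball T.root R \ ⋃ v ∈ T.net 0, T.branchSet c v) ≤
      4 * c * T.netMeasure 0 (Metric.closedBall T.root (R + 4 * netScale 0)) := by
  have hsub : Metric.ball T.root R \ ⋃ v ∈ T.net 0, T.branchSet c v ⊆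
      ⋃ n, T.awayFromGood c R n := by
    rintro x ⟨hx, hxB⟩
    by_contra hcon
    refine hxB (mem_iUnion₂.2 ?_)
    obtain ⟨v, hv, hxv⟩ := T.exists_mem_branchSet (c := c) (x := x) fun n => by
      by_contra! h
      exact hcon (mem_iUnion.2 ⟨n, hx, fun y hy hg => h y hy hg⟩)
    exact ⟨v, hv, hxv⟩
  refine (measure_mono hsub).trans ?_
  rw [(T.monotone_awayFromGood c R).measure_iUnion]
  refine iSup_le fun n => T.limitMeasure_le (T.isOpen_awayFromGood c R n) (n₀ := n) fun m hm => ?_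
  obtain ⟨j, rfl⟩ := Nat.exists_eq_add_of_le hm
  exact T.netMeasure_awayFromGood_le c R n j

theorem isOneRectifiable_limitMeasure (hX : IsLocallyQuasiconvex X) :
    IsOneRectifiable T.limitMeasure := by
  have : Nonempty X := ⟨T.root⟩
  let c : ℕ → ℝ≥0 := fun j => ((j + 1 : ℕ) : ℝ≥0)⁻¹
  have hc : ∀ j, 0 < c j := fun j => by positivity
  choose Γ hΓ hsub using fun (j : ℕ) (v : X) =>
    T.exists_isRectifiableCurve_branchSet_subset hX (hc j) v
  have : Countable (T.net 0) := (T.countable_net 0).to_subtype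
  have : Nonempty (T.net 0) := ⟨⟨T.root, T.root_mem 0⟩⟩
  obtain ⟨e, he⟩ := exists_surjective_nat (ℕ × T.net 0)
  refine ⟨fun i => Γ (e i).1 (e i).2, fun i => hΓ _ _, ?_⟩
  set N : Set X := univ \ ⋃ i, Γ (e i).1 (e i).2
  have hN : N ⊆ ⋃ R : ℕ, N ∩ Metric.ball T.root R := by
    rw [← inter_iUnion, Metric.iUnion_ball_nat, inter_univ]
  refine measure_mono_null hN (measure_iUnion_null fun R => ?_)
  set D := T.netMeasure 0 (Metric.closedBall T.root (R + 4 * netScale 0))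
  have hD : D ≠ ∞ := (T.netMeasure_lt_top 0 Metric.isClosed_closedBall.measurableSet
    Metric.isBounded_closedBall).ne
  have hle : ∀ j : ℕ, T.limitMeasure (N ∩ Metric.ball T.root R) ≤
      4 * D * ((j + 1 : ℕ) : ℝ≥0∞)⁻¹ := by
    intro j
    calc _ ≤ T.limitMeasure (Metric.ball T.root R \ ⋃ v ∈ T.net 0, T.branchSet (c j) v) := by
          refine measure_mono fun x hx => ⟨hx.2, fun hxB => hx.1.2 ?_⟩
          obtain ⟨v, hv, hxv⟩ := mem_iUnion₂.1 hxB
          obtain ⟨i, hi⟩ := he (j, ⟨v, hv⟩)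
          refine mem_iUnion.2 ⟨i, ?_⟩
          rw [hi]
          exact hsub j v hxv
      _ ≤ 4 * c j * D := T.limitMeasure_ball_diff_branchSet_le (c j) R
      _ = _ := by
          rw [ENNReal.coe_inv (by positivity), ENNReal.coe_natCast]
          ring
  have hlim : Filter.Tendsto (fun j : ℕ => 4 * D * ((j + 1 : ℕ) : ℝ≥0∞)⁻¹) Filter.atTop
      (nhds 0) := by
    have := ENNReal.Tendsto.const_mul (a := 4 * D)
      ((Filter.tendsto_add_atTop_iff_nat 1).2 ENNReal.tendsto_inv_nat_nhds_zero)
      (Or.inr (ENNReal.mul_ne_top (by simp) hD))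
    simpa using this
  exact le_antisymm (ge_of_tendsto' hlim hle) zero_le

end

end NetTree

theorem theorem1p4 {X : Type*} [MetricSpace X] [Nonempty X] [CompleteSpace X]
    [MeasurableSpace X] [BorelSpace X]
    (hdb : IsDoublingSpace X) (hqc : IsLocallyQuasiconvex X) :
    ∃ ν : Measure X, IsDoublingMeasure ν ∧ ν.support = Set.univ ∧ IsOneRectifiable ν := by
  have := hdb.properSpace
  obtain ⟨T⟩ := hdb.nonempty_netTree
  exact ⟨T.limitMeasure, T.isDoublingMeasure_limitMeasure, T.support_limitMeasure,
    T.isOneRectifiable_limitMeasure hqc⟩
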